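/- **Setting.** Let $\Gamma$ be the vertex set of a connected graph with graph distance $d$. To each $x\in\Gamma$ attach a finite-dimensional Hilbert space $\mathcal H_x$. For finite $X\subset\Gamma$ let $\mathcal H_X=\bigotimes_{x\in X}\mathcal H_x$ and let $\mathcal A_X$ be the algebra of operators on $\mathcal H_X$ with the operator norm; for $X\subset X'$ identify $A\in\mathcal A_X$ with $A\otimes 1\in\mathcal A_{X'}$ and say that $A$ has support in $X$. Let $F_0:[0,\infty)\to(0,\infty)$ be non-increasing, put $F_\mu(r)=e^{-\mu r}F_0(r)$, $\|F_0\|=\sup_x\sum_y F_0(d(x,y))$ and $C_\mu=\sup_{x,y}\sum_z F_\mu(d(x,z))F_\mu(d(z,y))/F_\mu(d(x,y))$, and assume $\|F_0\|<\infty$ and $C_0<\infty$ (hence $C_\mu<\infty$ for all $\mu\ge 0$). Fix $\mu>0$. Let $\Phi$ be an interaction, that is, a family of self-adjoint $\Phi(X)\in\mathcal A_X$, $X\subset\Gamma$ finite, with $$\sup_{x,y}\sum_{X\ni x,y}\frac{\|\Phi(X)\|}{F_\mu(d(x,y))}<\infty,$$ and let $\|\Phi\|'_\mu$ be the same supremum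 with the sum restricted to $|X|>1$. Let $\Lambda\subset\Gamma$ be a finite connected set, $K\subset\Lambda$, and for $x\in K$ let $W_x:[0,1]\to\mathcal A_{\{x\}}$ be a smooth path of self-adjoint operators with $W_x(0)=0$. Put $W=\sum_{x\in K}W_x$, let $C_W$ be a bound on $\|W'(s)\|$ for $s\in[0,1]$, and let $$H(s)=\sum_{X\subset\Lambda}\Phi(X)+W(s),\qquad s\in[0,1].$$ Assume that for every $s\in[0,1]$ the spectrum of $H(s)$ is a union $\sigma_{\rm in}(s)\cup\sigma_{\rm out}(s)$, where $\sigma_{\rm in}(s)$ is contained in an interval of length at most $L$ which does not meet $\sigma_{\rm out}(s)$, the distance between $\sigma_{\rm in}(s)$ and $\sigma_{\rm out}(s)$ is at least $g>0$, and the spectral projection $P(s)$ of $H(s)$ for $\sigma_{\rm in}(s)$ has rank $D$, with $D$ independent of $s$. For each $s$ let $\psi_1(s),\dots,\psi_D(s)$ be orthonormal eigenvectors of $H(s)$ with eigenvalues in $\sigma_{\rm in}(s)$. For $l>0$ let $K_l=\{x\in\Lambda: d(x,K)\le l\}$, let $|\sigma_{\rm in}(s)|$ be the number of distinct eigenvalues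 in $\sigma_{\rm in}(s)$, and let $$\xi=\frac{g+4C_\mu\|\Phi\|'_\mu}{\mu g}.$$ **Proposition 3.1.** For every $\mu'<1/\xi$ there are $\varepsilon_0>0$ and $C$, depending only on $\mu'$, $\mu$, $\|F_0\|$, $C_\mu$, $\|\Phi\|'_\mu$, $D$, $|K|$, $g$, $C_W$ and $L$ (in particular not on $\Lambda$), such that for all $0<\varepsilon<\varepsilon_0$, $s_0\in[0,1-\varepsilon]$, $i=1,\dots,D$ and $l>0$ there is an operator $R_i^l(s_0,\varepsilon)$ with support in $K_l$ satisfying $$\|R_i^l(s_0,\varepsilon)\|\le|\sigma_{\rm in}(s_0+\varepsilon)|$$ and $$\bigl\|\bigl(P(s_0+\varepsilon)-R_i^l(s_0,\varepsilon)\bigr)\psi_i(s_0)\bigr\|\le C\,\varepsilon\,e^{-\mu' l}.$$ -/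

import Mathlib

open scoped ENNReal NNReal ContDiff

noncomputable section

namespace SpinSystem

universe u

/-! ### Hilbert spaces and local observables

The vertex `x` carries the Hilbert space `ℂ ^ (d x)`.  The tensor product over a finite set `X` of
vertices is realised in its product basis, that is, as the space of square-summable functions on the
finite set of configurations `∏ x ∈ X, {0, …, d x - 1}`. -/

section Spaces

variable {Γ : Type u} [DecidableEq Γ] (d : Γ → ℕ)

/-- Labels of the product basis of `⨂ x ∈ X, ℂ ^ (d x)`. -/
abbrev Config (X : Finset Γ) : Type u := (x : X) → Fin (d x)

/-- The Hilbert space `⨂ x ∈ X, ℂ ^ (d x)`. -/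
abbrev HSpace (X : Finset Γ) : Type u := EuclideanSpace ℂ (Config d X)

/-- The algebra of observables on `X`, with the operator norm. -/
abbrev Obs (X : Finset Γ) : Type u := HSpace d X →L[ℂ] HSpace d X

variable {d}

/-- Restriction of a configuration on `Λ` to `X ⊆ Λ`. -/
def Config.restrict {X Λ : Finset Γ} (h : X ⊆ Λ) (σ : Config d Λ) : Config d X :=
  fun x => σ ⟨x, h x.2⟩

/-- The configuration on `Λ` that agrees with `τ` on `X` and with `σ` off `X`. -/
def Config.glue {X Λ : Finset Γ} (σ : Config d Λ) (τ : Config d X) : Config d Λ :=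
  fun x => if hx : (x : Γ) ∈ X then τ ⟨x, hx⟩ else σ x

/-- The observable `A ⊗ 1` on `Λ` defined by an observable `A` on `X ⊆ Λ`: for each fixed
configuration off `X`, the operator `A` acts on the variables in `X`. -/
def embed {X Λ : Finset Γ} (h : X ⊆ Λ) (A : Obs d X) : Obs d Λ :=
  LinearMap.toContinuousLinearMap
    { toFun := fun ψ => WithLp.toLp 2 fun σ : Config d Λ =>
        A (WithLp.toLp 2 fun τ : Config d X => ψ (σ.glue τ)) (σ.restrict h)
      map_add' := fun ψ φ => by
        ext σ
        exact congrArg (fun v : HSpace d X => v (σ.restrict h)) (A.map_add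
          (WithLp.toLp 2 fun τ : Config d X => ψ (σ.glue τ))
          (WithLp.toLp 2 fun τ : Config d X => φ (σ.glue τ)))
      map_smul' := fun c ψ => by
        ext σ
        exact congrArg (fun v : HSpace d X => v (σ.restrict h)) (A.map_smul c
          (WithLp.toLp 2 fun τ : Config d X => ψ (σ.glue τ))) }

/-- The observable `A` on `Λ` has support in `X`. -/
def IsSupportedIn {Λ : Finset Γ} (X : Finset Γ) (A : Obs d Λ) : Prop :=
  ∃ (h : X ⊆ Λ) (B : Obs d X), A = embed h B

end Spaces

/-! ### Geometry of the graph and decay functions -/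

section Geometry

variable {Γ : Type u} (G : SimpleGraph Γ)

/-- The `l`-fattening of `X` in the volume `Λ`: the sites of `Λ` at graph distance (in the whole
graph) at most `l` from `X`. -/
def fattening (Λ X : Finset Γ) (l : ℝ) : Finset Γ :=
  open Classical in Λ.filter fun x => ∃ y ∈ X, (G.dist y x : ℝ) ≤ l

/-- `F_μ(r) = e^{-μ r} F₀(r)`. -/
def expDecay (F₀ : ℝ → ℝ) (μ r : ℝ) : ℝ := Real.exp (-μ * r) * F₀ r

/-- `‖F‖ = sup_x ∑_y F(d(x,y))`. -/
def decayNorm (F : ℝ → ℝ) : ℝ≥0∞ :=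
  ⨆ x : Γ, ∑' y : Γ, ENNReal.ofReal (F (G.dist x y))

/-- `sup_{x,y} ∑_z F(d(x,z)) F(d(z,y)) / F(d(x,y))`. -/
def convConst (F : ℝ → ℝ) : ℝ≥0∞ :=
  ⨆ (x : Γ) (y : Γ), ∑' z : Γ,
    ENNReal.ofReal (F (G.dist x z) * F (G.dist z y) / F (G.dist x y))

/-- `F₀ : [0,∞) → (0,∞)` is non-increasing, uniformly summable and has the convolution property. -/
structure IsDecayFunction (F₀ : ℝ → ℝ) : Prop where
  pos : ∀ r, 0 ≤ r → 0 < F₀ r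
  antitone : AntitoneOn F₀ (Set.Ici 0)
  summable : decayNorm G F₀ < ⊤
  convolution : convConst G F₀ < ⊤

end Geometry

/-! ### Interactions and Hamiltonians -/

section Interactions

variable {Γ : Type u} [DecidableEq Γ] {d : Γ → ℕ} (G : SimpleGraph Γ)

/-- `‖Φ‖ = sup_{x,y} ∑_{X ∋ x,y} ‖Φ(X)‖ / F(d(x,y))`. -/
def interactionNorm (F : ℝ → ℝ) (Φ : (X : Finset Γ) → Obs d X) : ℝ≥0∞ :=
  ⨆ (x : Γ) (y : Γ), ∑' X : {X : Finset Γ // x ∈ X ∧ y ∈ X},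
    ENNReal.ofReal (‖Φ X.1‖ / F (G.dist x y))

/-- The same quantity without the single-site terms:
`‖Φ‖' = sup_{x,y} ∑_{X ∋ x,y, |X| > 1} ‖Φ(X)‖ / F(d(x,y))`. -/
def interactionNorm' (F : ℝ → ℝ) (Φ : (X : Finset Γ) → Obs d X) : ℝ≥0∞ :=
  ⨆ (x : Γ) (y : Γ), ∑' X : {X : Finset Γ // (x ∈ X ∧ y ∈ X) ∧ 1 < X.card},
    ENNReal.ofReal (‖Φ X.1‖ / F (G.dist x y))

/-- `H_Λ^Φ = ∑_{X ⊆ Λ} Φ(X)`. -/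
def hamiltonian (Φ : (X : Finset Γ) → Obs d X) (Λ : Finset Γ) : Obs d Λ :=
  ∑ X ∈ Λ.powerset.attach, embed (Finset.mem_powerset.mp X.2) (Φ X.1)

/-- `W(s) = ∑_{x ∈ K} W_x(s)` as an observable on `Λ ⊇ K`. -/
def perturbation {Λ K : Finset Γ} (hK : K ⊆ Λ) (W : (x : Γ) → ℝ → Obs d {x}) (s : ℝ) : Obs d Λ :=
  ∑ x ∈ K.attach, embed (Finset.singleton_subset_iff.mpr (hK x.2)) (W x s)

/-- `H_Λ(s) = H_Λ^Φ + W(s)`. -/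
def hamiltonianPath (Φ : (X : Finset Γ) → Obs d X) {Λ K : Finset Γ} (hK : K ⊆ Λ)
    (W : (x : Γ) → ℝ → Obs d {x}) (s : ℝ) : Obs d Λ :=
  hamiltonian Φ Λ + perturbation hK W s

/-- Smooth paths, on `[0,1]`, of self-adjoint single-site operators at the sites of `K`, starting
at `0`, whose sum `W` has a derivative of norm at most `CW`. -/
structure IsPerturbation {Λ K : Finset Γ} (hK : K ⊆ Λ) (W : (x : Γ) → ℝ → Obs d {x})
    (CW : ℝ) : Prop where
  smooth : ∀ x ∈ K, ContDiffOn ℝ ∞ (W x) (Set.Icc 0 1)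
  selfAdjoint : ∀ x ∈ K, ∀ s ∈ Set.Icc (0 : ℝ) 1, IsSelfAdjoint (W x s)
  zero : ∀ x ∈ K, W x 0 = 0
  deriv_le : ∀ s ∈ Set.Icc (0 : ℝ) 1,
    ‖derivWithin (perturbation hK W) (Set.Icc 0 1) s‖ ≤ CW

end Interactions

/-! ### Gapped sectors -/

section Sectors

variable {E : Type u} [NormedAddCommGroup E] [InnerProductSpace ℂ E] [FiniteDimensional ℂ E]

/-- The span of the eigenvectors of `H` with eigenvalue in `S`. -/
def sectorSpace (H : E →L[ℂ] E) (S : Set ℝ) : Submodule ℂ E :=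
  ⨆ a ∈ S, Module.End.eigenspace (H : E →ₗ[ℂ] E) (a : ℂ)

/-- The orthogonal projection onto `sectorSpace H S`. -/
def sectorProj (H : E →L[ℂ] E) (S : Set ℝ) : E →L[ℂ] E :=
  (sectorSpace H S).starProjection

/-- The spectrum of `H` is the union of `σin` and `σout`, which are at distance at least `g`;
`σin` lies in an interval of length at most `L` that does not meet `σout`; the sector of `σin` has
dimension `D`. -/
structure IsGappedSector (H : E →L[ℂ] E) (σin σout : Set ℝ) (g L : ℝ) (D : ℕ) : Prop where
  spectrum_eq : spectrum ℝ H = σin ∪ σout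
  interval : ∃ a b : ℝ, b - a ≤ L ∧ σin ⊆ Set.Icc a b ∧ Disjoint (Set.Icc a b) σout
  gap : ∀ x ∈ σin, ∀ y ∈ σout, g ≤ |x - y|
  finrank_eq : Module.finrank ℂ (sectorSpace H σin) = D

end Sectors

/-- The length `ξ = (g + 4 C_μ ‖Φ‖'_μ) / (μ g)`. -/
def localityLength (μ g : ℝ) (Cμ normΦ : ℝ≥0) : ℝ := (g + 4 * Cμ * normΦ) / (μ * g)

end SpinSystem

end

/-! Put `H = H(s₀+ε)` and `V = W(s₀+ε) - W(s₀)`, so that `ψ = ψ_i(s₀)` is an eigenvector of `H - V`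
with some eigenvalue `e`, and `‖V‖ = O(ε)`. Then `e^{itH} e^{-it(H-V)} ψ = e^{it(H-e)} ψ`: any
Fourier sum in `H - e` acts on `ψ` as a combination of propagators `e^{itH} e^{-it(H-V)}`. These are
generated by `V`, which lives on `K`, and are therefore quasi-local near `K`.

Locality: a Lieb–Robinson argument (`norm_commutator_intertwiner_le`,
`norm_propagator_sub_propagator_le`) replaces `H` by its restriction to `K_l`, at a cost of order
`‖V‖ t² e^{v|t| - μ l}` with `v = 2 C_μ ‖Φ‖'_μ`. Single-site terms do not enter `v`.

Filtering: the indicator of `σ_in` is approximated on the spectrum by a Fourier sum with times in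
`[-T, T]`. A Dolph–Chebyshev window (`exists_window`) is of order `e^{-Tr}` beyond distance `r`; its
primitive is a step, and two steps placed half a gap beyond the extreme points of `σ_in` make a band
(`exists_band_filter`). The filter is matched exactly at `e`, so its error at `x` is at most `δ|x -
e|`; since `(H - e)ψ = Vψ`, the error on `ψ` is at most `δ‖V‖` (`norm_apply_le_of_diagonal`). This
produces the factor `ε`.

Rate: `T = θ l` with `θ = μ/(v + r)` equates `e^{-Tr}` and `e^{vT - μ l}`. As `r` tends to `g/2` the
rate `θ r` tends to `μ g/(g + 2v) = 1/ξ`.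

Norm: `‖U(t) - 1‖ ≤ ‖V‖|t|` and a bound on `∑ |w_j||t_j|` uniform in `T` put the band filter within
distance `1` of `0` or of the identity. Its norm is thus at most `1` or `2`. Only when `σ_in` is a
single point close to `e` is this too much; then a peak filter of total weight `1` is used
(`exists_peak_filter`). Continuity of `σ_in(s)` in `s` plays no role: `e` may lie near either part
of the spectrum. -/

open scoped ENNReal NNReal ContDiff

noncomputable section

namespace SpinSystem

universe u

/-! ### Unitary groups in a C*-algebra. -/

section Evolution

variable {𝔄 : Type*} [CStarAlgebra 𝔄]

/-- The one-parameter group `t ↦ e^{i t a}`. -/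
def evol (a : 𝔄) (t : ℝ) : 𝔄 := NormedSpace.exp (t • (Complex.I • a))

lemma evol_zero (a : 𝔄) : evol a 0 = 1 := by simp [evol]

lemma evol_neg_neg (a : 𝔄) (t : ℝ) : evol (-a) (-t) = evol a t := by simp [evol]

lemma evol_add_of_commute {a b : 𝔄} (h : Commute a b) (t : ℝ) :
    evol (a + b) t = evol a t * evol b t := by
  let _ : NormedAlgebra ℚ 𝔄 := NormedAlgebra.restrictScalars ℚ ℝ 𝔄
  have h' : Commute (t • (Complex.I • a)) (t • (Complex.I • b)) :=
    (((h.smul_left _).smul_right _).smul_left _).smul_right _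
  rw [evol, evol, evol, ← NormedSpace.exp_add_of_commute h', smul_add, smul_add]

lemma evol_mul_evol_neg (a : 𝔄) (t : ℝ) : evol a t * evol (-a) t = 1 := by
  rw [← evol_add_of_commute (Commute.refl a).neg_right, add_neg_cancel]
  simp [evol]

lemma evol_neg_mul_evol (a : 𝔄) (t : ℝ) : evol (-a) t * evol a t = 1 := by
  simpa using evol_mul_evol_neg (-a) t

lemma Commute.evol_right {a b : 𝔄} (h : Commute a b) (t : ℝ) : Commute a (evol b t) := by
  let _ : NormedAlgebra ℚ 𝔄 := NormedAlgebra.restrictScalars ℚ ℝ 𝔄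
  exact ((h.smul_right _).smul_right _).exp_right

lemma evol_mem_unitary {a : 𝔄} (ha : IsSelfAdjoint a) (t : ℝ) : evol a t ∈ unitary 𝔄 := by
  let _ : NormedAlgebra ℚ 𝔄 := NormedAlgebra.restrictScalars ℚ ℝ 𝔄
  apply NormedSpace.exp_mem_unitary_of_mem_skewAdjoint
  rw [skewAdjoint.mem_iff, star_smul, star_smul, ha.star_eq]
  simp

lemma norm_evol_mul {a : 𝔄} (ha : IsSelfAdjoint a) (t : ℝ) (b : 𝔄) : ‖evol a t * b‖ = ‖b‖ :=
  CStarRing.norm_coe_unitary_mul ⟨_, evol_mem_unitary ha t⟩ b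

lemma norm_mul_evol {a : 𝔄} (ha : IsSelfAdjoint a) (t : ℝ) (b : 𝔄) : ‖b * evol a t‖ = ‖b‖ :=
  CStarRing.norm_mul_coe_unitary b ⟨_, evol_mem_unitary ha t⟩

lemma norm_one_le : ‖(1 : 𝔄)‖ ≤ 1 := by
  have h := CStarRing.norm_self_mul_star (x := (1 : 𝔄))
  rw [star_one, one_mul] at h
  nlinarith [norm_nonneg (1 : 𝔄)]

lemma norm_evol_le {a : 𝔄} (ha : IsSelfAdjoint a) (t : ℝ) : ‖evol a t‖ ≤ 1 := by
  have h := norm_evol_mul ha t 1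
  rw [mul_one] at h
  exact h.trans_le norm_one_le

lemma hasDerivAt_evol (a : 𝔄) (t : ℝ) :
    HasDerivAt (evol a) (evol a t * (Complex.I • a)) t :=
  hasDerivAt_exp_smul_const (𝕂 := ℝ) (Complex.I • a) t

lemma hasDerivAt_evol' (a : 𝔄) (t : ℝ) :
    HasDerivAt (evol a) ((Complex.I • a) * evol a t) t :=
  hasDerivAt_exp_smul_const' (𝕂 := ℝ) (Complex.I • a) t

/-- A product of four evolutions stays close to `1` as long as the generators nearly intertwine. -/
theorem norm_evol_prod_sub_one_le {a b c d : 𝔄} (ha : IsSelfAdjoint a)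
    (hd : IsSelfAdjoint d) {B B' : ℝ → ℝ} (hB0 : B 0 = 0)
    (hB : ∀ t, HasDerivAt B (B' t) t)
    (hle : ∀ t, 0 ≤ t → ‖(a - b) * (evol (-b) t * evol c t)
      + evol (-b) t * evol c t * (c - d)‖ ≤ B' t) {t : ℝ} (ht : 0 ≤ t) :
    ‖evol a t * (evol (-b) t * evol c t) * evol (-d) t - 1‖ ≤ B t := by
  set f' : ℝ → 𝔄 := fun s => evol a s * (Complex.I • ((a - b) * (evol (-b) s * evol c s)
      + evol (-b) s * evol c s * (c - d))) * evol (-d) s with hf'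
  -- Differentiating the two inner factors on the outside of their product, and the outer factors on
  -- the inside, leaves only the differences `a - b` and `c - d`, between unitaries.
  have hf : ∀ s, HasDerivAt
      (fun s => evol a s * (evol (-b) s * evol c s) * evol (-d) s - 1) (f' s) s := by
    intro s
    have h := (((hasDerivAt_evol a s).mul
      ((hasDerivAt_evol' (-b) s).mul (hasDerivAt_evol c s))).mul
        (hasDerivAt_evol' (-d) s)).sub_const 1
    refine h.congr_deriv ?_
    simp only [hf', Pi.mul_apply, smul_neg, mul_assoc, smul_mul_assoc, mul_smul_comm, mul_add, add_mul, mul_sub,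
      sub_mul, smul_add, smul_sub, neg_mul, mul_neg]
    abel
  refine image_norm_le_of_norm_deriv_right_le_deriv_boundary (a := 0) (b := t)
    (fun s _ => (hf s).continuousAt.continuousWithinAt) (fun s _ => (hf s).hasDerivWithinAt)
    ?_ hB ?_ ⟨ht, le_rfl⟩
  · simp [evol_zero, hB0]
  · intro s hs
    rw [hf', norm_mul_evol hd.neg, norm_evol_mul ha, norm_smul, Complex.norm_I, one_mul]
    exact hle s hs.1

/-- The part `q` is invisible to `A`, so the Heisenberg evolution of `A` under `k + q` is the one
under `k` alone. -/
lemma mul_evol_neg_add {k q A : 𝔄} (hkq : Commute k q) (hA : Commute A q) (t : ℝ) :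
    A * evol (-(k + q)) t = evol (-(k + q)) t * (evol k t * A * evol (-k) t) := by
  have h1 : evol (-(k + q)) t = evol (-k) t * evol (-q) t := by
    rw [neg_add, evol_add_of_commute hkq.neg_left.neg_right]
  have h2 : evol (-q) t * evol k t = evol k t * evol (-q) t :=
    (Commute.evol_right (Commute.evol_right hkq.symm.neg_left t).symm t).eq.symm
  have h3 : evol (-q) t * A = A * evol (-q) t := (Commute.evol_right hA.neg_right t).eq.symm
  have h4 : evol (-q) t * evol (-k) t = evol (-k) t * evol (-q) t :=
    (Commute.evol_right (Commute.evol_right hkq.neg_left.neg_right.symm t).symm t).eq.symm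
  calc A * evol (-(k + q)) t = A * (evol (-k) t * evol (-q) t) := by rw [h1]
    _ = evol (-k) t * evol k t * (A * (evol (-q) t * evol (-k) t)) := by
        rw [evol_neg_mul_evol, one_mul, h4]
    _ = evol (-k) t * (evol k t * ((A * evol (-q) t) * evol (-k) t)) := by
        simp only [mul_assoc]
    _ = evol (-k) t * ((evol k t * evol (-q) t) * (A * evol (-k) t)) := by
        rw [← h3]; simp only [mul_assoc]
    _ = _ := by rw [← h2, h1]; simp only [mul_assoc]

lemma evol_add_mul {k q A : 𝔄} (hkq : Commute k q) (hA : Commute A q) (t : ℝ) :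
    evol (k + q) t * A = (evol k t * A * evol (-k) t) * evol (k + q) t := by
  have h3 : evol q t * A = A * evol q t := (Commute.evol_right hA t).eq.symm
  rw [evol_add_of_commute hkq, mul_assoc, h3]
  calc _ = evol k t * A * 1 * evol q t := by simp only [mul_assoc, mul_one]
    _ = _ := by rw [← evol_neg_mul_evol k t]; simp only [mul_assoc]

/-- The commutator of `A` with `G` is controlled by the deviation from `1` of
`e^{ith} G e^{-ith'}`, if `h` and `h'` agree up to terms that commute with `A`. -/
lemma norm_commutator_le_of_evol {k q q' A G : 𝔄} (hk : IsSelfAdjoint k) (hq : IsSelfAdjoint q)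
    (hq' : IsSelfAdjoint q') (hkq : Commute k q) (hkq' : Commute k q') (hA : Commute A q)
    (hA' : Commute A q') (t : ℝ) :
    ‖A * G - G * A‖ ≤ 2 * ‖A‖ * ‖evol (k + q) t * G * evol (-(k + q')) t - 1‖ := by
  set Ω := evol (k + q) t * G * evol (-(k + q')) t with hΩ
  set A' := evol k t * A * evol (-k) t with hA'
  have hG : G = evol (-(k + q)) t * Ω * evol (k + q') t := by
    calc G = (evol (-(k + q)) t * evol (k + q) t) * G
          * (evol (-(k + q')) t * evol (k + q') t) := by
            rw [evol_neg_mul_evol, evol_neg_mul_evol, one_mul, mul_one]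
      _ = _ := by rw [hΩ]; simp only [mul_assoc]
  have e1 : A * G = evol (-(k + q)) t * (A' * Ω) * evol (k + q') t := by
    rw [hG, ← mul_assoc, ← mul_assoc, mul_evol_neg_add hkq hA]
    simp only [hA', mul_assoc]
  have e2 : G * A = evol (-(k + q)) t * (Ω * A') * evol (k + q') t := by
    rw [hG, mul_assoc, evol_add_mul hkq' ‹Commute A q'›]
    simp only [hA', mul_assoc]
  -- Both `k + q` and `k + q'` evolve `A` into the same `A'`, so `[A, G]` is unitarily equivalent to
  -- `[A', Ω]`, where `1` may be subtracted from `Ω`.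
  have e3 : A * G - G * A
      = evol (-(k + q)) t * (A' * (Ω - 1) - (Ω - 1) * A') * evol (k + q') t := by
    rw [e1, e2, ← sub_mul, ← mul_sub]
    congr 2
    noncomm_ring
  have e4 : ‖A'‖ = ‖A‖ := by rw [hA', norm_mul_evol hk.neg, norm_evol_mul hk]
  rw [e3, norm_mul_evol (hk.add hq'), norm_evol_mul (hk.add hq).neg]
  calc _ ≤ ‖A' * (Ω - 1)‖ + ‖(Ω - 1) * A'‖ := norm_sub_le _ _
    _ ≤ ‖A'‖ * ‖Ω - 1‖ + ‖Ω - 1‖ * ‖A'‖ := add_le_add (norm_mul_le _ _) (norm_mul_le _ _)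
    _ = _ := by rw [e4]; ring

end Evolution

/-! ### Lieb–Robinson bounds and localisation of propagators. -/

section Locality

variable {Γ : Type*} [DecidableEq Γ] {𝔄 : Type*} [CStarAlgebra 𝔄]

lemma sum_le_sum_sum_of_exists {ι κ : Type*} {s : Finset κ} {t : Finset ι} {u : ι → Finset κ}
    {f : κ → ℝ} (hf : ∀ k, 0 ≤ f k) (h : ∀ k ∈ s, ∃ i ∈ t, k ∈ u i) :
    ∑ k ∈ s, f k ≤ ∑ i ∈ t, ∑ k ∈ u i, f k := by
  classical
  calc ∑ k ∈ s, f k ≤ ∑ k ∈ s, ∑ i ∈ t, if k ∈ u i then f k else 0 := by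
        refine Finset.sum_le_sum fun k hk => ?_
        obtain ⟨i, hi, hki⟩ := h k hk
        calc f k = if k ∈ u i then f k else 0 := by simp [hki]
          _ ≤ _ := Finset.single_le_sum
            (f := fun i => if k ∈ u i then f k else 0)
            (fun j _ => by split_ifs <;> simp [hf]) hi
    _ = ∑ i ∈ t, ∑ k ∈ s, if k ∈ u i then f k else 0 := Finset.sum_comm
    _ ≤ ∑ i ∈ t, ∑ k ∈ u i, f k := by
        refine Finset.sum_le_sum fun i _ => ?_
        rw [← Finset.sum_filter]
        exact Finset.sum_le_sum_of_subset_of_nonneg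
          (fun k hk => (Finset.mem_filter.1 hk).2) fun k _ _ => hf k

/-- The sets `Z ⊆ P` that meet `X` without being contained in it. -/
def surface (X P : Finset Γ) : Finset (Finset Γ) :=
  P.powerset.filter fun Z => ¬ (Z ⊆ X ∨ Disjoint X Z)

/-- The product `e^{-itH} e^{itH_M}` of the evolutions in the volumes `Λ` and `M`. -/
def intertwiner (Ψ : Finset Γ → 𝔄) (Λ M : Finset Γ) (t : ℝ) : 𝔄 :=
  evol (-∑ Z ∈ Λ.powerset, Ψ Z) t * evol (∑ Z ∈ M.powerset, Ψ Z) t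

/-- The interaction splits into a part inside `X`, a part away from `X` and the terms crossing the
boundary of `X`. The empty set is both inside and disjoint, hence the extra condition in the second
sum. -/
lemma sum_powerset_eq (Ψ : Finset Γ → 𝔄) {X P : Finset Γ} (h : X ⊆ P) :
    ∑ Z ∈ P.powerset, Ψ Z = (∑ Z ∈ X.powerset, Ψ Z +
      ∑ Z ∈ P.powerset.filter (fun Z => ¬ Z ⊆ X ∧ Disjoint X Z), Ψ Z)
        + ∑ Z ∈ surface X P, Ψ Z := by
  rw [← Finset.sum_filter_add_sum_filter_not P.powerset (fun Z => Z ⊆ X),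
    ← Finset.sum_filter_add_sum_filter_not (P.powerset.filter fun Z => ¬ Z ⊆ X)
      (fun Z => Disjoint X Z), Finset.filter_filter, Finset.filter_filter, surface, add_assoc]
  congr 2
  · ext Z
    simp only [Finset.mem_filter, Finset.mem_powerset, and_iff_right_iff_imp]
    exact fun hZ => hZ.trans h
  · simp only [not_or]

/-- One step of the Lieb–Robinson iteration. Dropping the crossing terms decouples `X` from its
complement in both volumes without changing the evolution of `A`. The error is driven by commutators
of the intertwiner with the crossing terms in `M`, which are of the same kind as the quantity being
bounded, and by the crossing terms that leave `M`, which are estimated by their norms. -/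
lemma norm_commutator_intertwiner_le_aux {Λ M X : Finset Γ} {Ψ : Finset Γ → 𝔄}
    (hM : M ⊆ Λ) (hX : X ⊆ M) (hsa : ∀ Z, IsSelfAdjoint (Ψ Z))
    (hcomm : ∀ Y Z, Disjoint Y Z → Commute (Ψ Y) (Ψ Z)) {A : 𝔄}
    (hA : ∀ Z, Z ⊆ Λ → Disjoint X Z → Commute A (Ψ Z))
    {B B' : ℝ → ℝ} (hB0 : B 0 = 0) (hB : ∀ t, HasDerivAt B (B' t) t)
    (hle : ∀ t, 0 ≤ t → ∑ Z ∈ surface X M, ‖Ψ Z * intertwiner Ψ Λ M t - intertwiner Ψ Λ M t * Ψ Z‖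
      + ∑ Z ∈ surface X Λ \ surface X M, ‖Ψ Z‖ ≤ B' t) {t : ℝ} (ht : 0 ≤ t) :
    ‖A * intertwiner Ψ Λ M t - intertwiner Ψ Λ M t * A‖ ≤ 2 * ‖A‖ * B t := by
  set k := ∑ Z ∈ X.powerset, Ψ Z
  set q := fun P : Finset Γ => ∑ Z ∈ P.powerset.filter (fun Z => ¬ Z ⊆ X ∧ Disjoint X Z), Ψ Z
    with hq
  have hsum : ∀ s : Finset (Finset Γ), IsSelfAdjoint (∑ Z ∈ s, Ψ Z) := fun s =>
    isSelfAdjoint_sum _ fun Z _ => hsa Z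
  have hkq : ∀ P, Commute k (q P) := fun P => Commute.sum_left _ _ _ fun Y hY =>
    Commute.sum_right _ _ _ fun Z hZ => hcomm _ _
      (Disjoint.mono_left (Finset.mem_powerset.1 hY) (Finset.mem_filter.1 hZ).2.2)
  have hAq : ∀ P, P ⊆ Λ → Commute A (q P) := fun P hP => Commute.sum_right _ _ _ fun Z hZ =>
    hA Z ((Finset.mem_powerset.1 (Finset.mem_filter.1 hZ).1).trans hP) (Finset.mem_filter.1 hZ).2.2
  refine (norm_commutator_le_of_evol (hsum X.powerset) (hsum _) (hsum _) (hkq Λ) (hkq M)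
    (hAq Λ le_rfl) (hAq M hM) t).trans ?_
  refine mul_le_mul_of_nonneg_left ?_ (by positivity)
  refine norm_evol_prod_sub_one_le ((hsum _).add (hsum _)) ((hsum _).add (hsum _)) hB0 hB
    (fun s hs => ?_) ht
  have eΛ := sum_powerset_eq Ψ (hX.trans hM)
  have eM := sum_powerset_eq Ψ hX
  set SM := surface X M
  have hsub : SM ⊆ surface X Λ :=
    Finset.filter_subset_filter _ (Finset.powerset_mono.2 hM)
  have e1 : (k + q Λ) - ∑ Z ∈ Λ.powerset, Ψ Z
      = -(∑ Z ∈ SM, Ψ Z + ∑ Z ∈ surface X Λ \ SM, Ψ Z) := by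
    rw [eΛ, ← Finset.sum_sdiff hsub]; abel
  have e2 : ∑ Z ∈ M.powerset, Ψ Z - (k + q M) = ∑ Z ∈ SM, Ψ Z := by
    rw [eM]; abel
  change ‖((k + q Λ) - _) * intertwiner Ψ Λ M s + intertwiner Ψ Λ M s * (_ - (k + q M))‖ ≤ _
  rw [e1, e2]
  set G := intertwiner Ψ Λ M s with hG
  have hGn : ∀ b, ‖b * G‖ = ‖b‖ := fun b => by
    rw [hG, intertwiner, ← mul_assoc, norm_mul_evol (hsum _), norm_mul_evol (hsum _).neg]
  have e3 : -(∑ Z ∈ SM, Ψ Z + ∑ Z ∈ surface X Λ \ SM, Ψ Z) * G + G * ∑ Z ∈ SM, Ψ Z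
      = -(∑ Z ∈ SM, (Ψ Z * G - G * Ψ Z) + (∑ Z ∈ surface X Λ \ SM, Ψ Z) * G) := by
    rw [Finset.sum_sub_distrib, ← Finset.sum_mul, ← Finset.mul_sum]; noncomm_ring
  rw [e3, norm_neg]
  refine (norm_add_le _ _).trans ((add_le_add (norm_sum_le _ _) ?_).trans (hle s hs))
  rw [hGn]
  exact norm_sum_le _ _

/-- Quasi-locality of the dynamics: if `A` lives on `X ⊆ M`, its evolutions in the volumes
`Λ` and `M` differ only by the influence of `Λ \ M`. -/
theorem norm_commutator_intertwiner_le {Λ M : Finset Γ} {Ψ : Finset Γ → 𝔄}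
    (hM : M ⊆ Λ) (hsa : ∀ Z, IsSelfAdjoint (Ψ Z))
    (hcomm : ∀ Y Z, Disjoint Y Z → Commute (Ψ Y) (Ψ Z)) {F : Γ → Γ → ℝ} {J C : ℝ}
    (hF : ∀ y z, 0 ≤ F y z) (hJ0 : 0 ≤ J) (hC0 : 0 ≤ C)
    (hJ : ∀ y ∈ Λ, ∀ z ∈ Λ, ∑ Z ∈ Λ.powerset.filter (fun Z => (y ∈ Z ∧ z ∈ Z) ∧ 1 < Z.card), ‖Ψ Z‖
      ≤ J * F y z)
    (hC : ∀ y ∈ Λ, ∀ z ∈ Λ, ∑ u ∈ Λ, F y u * F u z ≤ C * F y z)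
    {X : Finset Γ} (hX : X ⊆ M) {A : 𝔄} (hA : ∀ Z, Z ⊆ Λ → Disjoint X Z → Commute A (Ψ Z))
    {t : ℝ} (ht : 0 ≤ t) :
    ‖A * intertwiner Ψ Λ M t - intertwiner Ψ Λ M t * A‖ ≤
      ‖A‖ * ((∑ y ∈ X, ∑ z ∈ Λ \ M, F y z) * (2 * J * t * Real.exp (2 * J * C * t))) := by
  set σ : Finset Γ → ℝ := fun X => ∑ y ∈ X, ∑ z ∈ Λ \ M, F y z with hσ
  set v := 2 * J * C with hv
  have hv0 : 0 ≤ v := by positivity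
  set b := ∑ Z ∈ Λ.powerset, ‖Ψ Z‖ with hb
  have hσ0 : ∀ X, 0 ≤ σ X := fun X => Finset.sum_nonneg fun y _ => Finset.sum_nonneg fun z _ => hF y z
  set T : Γ → Γ → Finset (Finset Γ) := fun y z =>
    Λ.powerset.filter (fun Z => (y ∈ Z ∧ z ∈ Z) ∧ 1 < Z.card) with hT
  have hsurf : ∀ {X P Z : Finset Γ}, Z ∈ surface X P →
      Z ⊆ P ∧ (∃ y ∈ X, y ∈ Z) ∧ 1 < Z.card := by
    intro X P Z hZ
    rw [surface, Finset.mem_filter, Finset.mem_powerset, not_or] at hZ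
    obtain ⟨h1, h2, h3⟩ := hZ
    obtain ⟨y, hyX, hyZ⟩ := Finset.not_disjoint_iff.1 h3
    obtain ⟨z, hzZ, hzX⟩ := Finset.not_subset.1 h2
    -- A crossing set has a point in `X` and one outside. This is why only the interaction without
    -- single-site terms matters.
    exact ⟨h1, ⟨y, hyX, hyZ⟩, Finset.one_lt_card.2 ⟨y, hyZ, z, hzZ, fun h => hzX (h ▸ hyX)⟩⟩
  -- the terms through which the influence of `Λ \ M` enters directly
  have hout : ∀ X, X ⊆ M → ∑ Z ∈ surface X Λ \ surface X M, ‖Ψ Z‖ ≤ J * σ X := by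
    intro X hX
    calc _ ≤ ∑ p ∈ X ×ˢ (Λ \ M), ∑ Z ∈ T p.1 p.2, ‖Ψ Z‖ := by
          refine sum_le_sum_sum_of_exists (fun _ => norm_nonneg _) fun Z hZ => ?_
          obtain ⟨hZ1, hZ2⟩ := Finset.mem_sdiff.1 hZ
          obtain ⟨h1, ⟨y, hyX, hyZ⟩, h3⟩ := hsurf hZ1
          have h4 : ¬ Z ⊆ M := fun h => hZ2 <| Finset.mem_filter.2
            ⟨Finset.mem_powerset.2 h, (Finset.mem_filter.1 hZ1).2⟩
          obtain ⟨z, hzZ, hzM⟩ := Finset.not_subset.1 h4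
          exact ⟨(y, z), Finset.mem_product.2 ⟨hyX, Finset.mem_sdiff.2 ⟨h1 hzZ, hzM⟩⟩,
            Finset.mem_filter.2 ⟨Finset.mem_powerset.2 h1, ⟨hyZ, hzZ⟩, h3⟩⟩
      _ ≤ ∑ p ∈ X ×ˢ (Λ \ M), J * F p.1 p.2 := by
          refine Finset.sum_le_sum fun p hp => ?_
          obtain ⟨h1, h2⟩ := Finset.mem_product.1 hp
          exact hJ _ (hM (hX h1)) _ (Finset.mem_sdiff.1 h2).1
      _ = J * σ X := by rw [Finset.sum_product, hσ, Finset.mul_sum]; simp_rw [Finset.mul_sum]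
  -- the propagation through the interaction
  have hprop : ∀ X, X ⊆ M → ∑ Z ∈ surface X M, ‖Ψ Z‖ * σ Z ≤ J * C * σ X := by
    intro X hX
    have hZ1 : ∀ Z, Z ⊆ Λ → σ Z = ∑ u ∈ Λ, if u ∈ Z then ∑ z ∈ Λ \ M, F u z else 0 := by
      intro Z hZ
      rw [← Finset.sum_filter, hσ]
      congr 1
      ext u; simp only [Finset.mem_filter]; exact ⟨fun h => ⟨hZ h, h⟩, fun h => h.2⟩
    calc _ ≤ ∑ y ∈ X, ∑ Z ∈ Λ.powerset.filter (fun Z => y ∈ Z ∧ 1 < Z.card), ‖Ψ Z‖ * σ Z := by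
          refine sum_le_sum_sum_of_exists (fun Z => mul_nonneg (norm_nonneg _) (hσ0 Z))
            fun Z hZ => ?_
          obtain ⟨h1, ⟨y, hyX, hyZ⟩, h3⟩ := hsurf hZ
          exact ⟨y, hyX, Finset.mem_filter.2 ⟨Finset.mem_powerset.2 (h1.trans hM), hyZ, h3⟩⟩
      _ = ∑ y ∈ X, ∑ u ∈ Λ, (∑ Z ∈ T y u, ‖Ψ Z‖) * ∑ z ∈ Λ \ M, F u z := by
          refine Finset.sum_congr rfl fun y _ => ?_
          calc _ = ∑ Z ∈ Λ.powerset.filter (fun Z => y ∈ Z ∧ 1 < Z.card), ∑ u ∈ Λ,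
                if u ∈ Z then ‖Ψ Z‖ * ∑ z ∈ Λ \ M, F u z else 0 := by
                refine Finset.sum_congr rfl fun Z hZ => ?_
                rw [hZ1 Z (Finset.mem_powerset.1 (Finset.mem_filter.1 hZ).1), Finset.mul_sum]
                simp_rw [mul_ite, mul_zero]
            _ = _ := by
                rw [Finset.sum_comm]
                refine Finset.sum_congr rfl fun u _ => ?_
                rw [Finset.sum_mul, ← Finset.sum_filter, Finset.filter_filter]
                refine Finset.sum_congr ?_ fun _ _ => rfl
                ext Z; simp only [hT, Finset.mem_filter]; tauto
      _ ≤ ∑ y ∈ X, ∑ u ∈ Λ, J * F y u * ∑ z ∈ Λ \ M, F u z := by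
          refine Finset.sum_le_sum fun y hy => Finset.sum_le_sum fun u hu => ?_
          exact mul_le_mul_of_nonneg_right (hJ y (hM (hX hy)) u hu)
            (Finset.sum_nonneg fun z _ => hF u z)
      _ = ∑ y ∈ X, ∑ z ∈ Λ \ M, J * ∑ u ∈ Λ, F y u * F u z := by
          refine Finset.sum_congr rfl fun y _ => ?_
          simp_rw [Finset.mul_sum]
          rw [Finset.sum_comm]
          simp_rw [mul_assoc]
      _ ≤ ∑ y ∈ X, ∑ z ∈ Λ \ M, J * (C * F y z) := by
          refine Finset.sum_le_sum fun y hy => Finset.sum_le_sum fun z hz => ?_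
          exact mul_le_mul_of_nonneg_left (hC y (hM (hX hy)) z (Finset.mem_sdiff.1 hz).1) hJ0
      _ = J * C * σ X := by
          rw [hσ, Finset.mul_sum]; simp_rw [Finset.mul_sum, mul_assoc]
  have hrest : ∀ X, ∑ Z ∈ surface X M, ‖Ψ Z‖ ≤ b := fun X =>
    Finset.sum_le_sum_of_subset_of_nonneg
      ((Finset.filter_subset _ _).trans (Finset.powerset_mono.2 hM)) fun _ _ _ => norm_nonneg _
  have hb0 : 0 ≤ b := Finset.sum_nonneg fun _ _ => norm_nonneg _
  -- iterate
  have key : ∀ N : ℕ, ∀ X, X ⊆ M → ∀ A : 𝔄, (∀ Z, Z ⊆ Λ → Disjoint X Z → Commute A (Ψ Z)) →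
      ∀ t : ℝ, 0 ≤ t → ‖A * intertwiner Ψ Λ M t - intertwiner Ψ Λ M t * A‖ ≤
        ‖A‖ * (σ X * (2 * J * t * Real.exp (v * t)) + 2 * ((2 * b * t) ^ N / N.factorial)) := by
    intro N
    -- `N` counts iterations. The last term bounds what remains after them; it contains the
    -- volume-dependent constant `b`, harmless because it vanishes as `N → ∞`.
    induction N with
    | zero =>
      intro X _ A _ t ht
      have hn1 : ‖A * intertwiner Ψ Λ M t‖ = ‖A‖ := by
        rw [intertwiner, ← mul_assoc, norm_mul_evol (isSelfAdjoint_sum _ fun Z _ => hsa Z),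
          norm_mul_evol (isSelfAdjoint_sum _ fun Z _ => hsa Z).neg]
      have hn2 : ‖intertwiner Ψ Λ M t * A‖ = ‖A‖ := by
        rw [intertwiner, mul_assoc, norm_evol_mul (isSelfAdjoint_sum _ fun Z _ => hsa Z).neg,
          norm_evol_mul (isSelfAdjoint_sum _ fun Z _ => hsa Z)]
      refine (norm_sub_le _ _).trans ?_
      rw [hn1, hn2]
      have h0 : 0 ≤ ‖A‖ * (σ X * (2 * J * t * Real.exp (v * t))) :=
        mul_nonneg (norm_nonneg _) (mul_nonneg (hσ0 X) (by positivity))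
      simp only [pow_zero, Nat.factorial_zero, Nat.cast_one, div_one, mul_one]
      linarith
    | succ N ih =>
      intro X hX A hA t ht
      -- The factor `1/2` offsets the `2 * ‖A‖` of the one-step lemma. The choice `v = 2JC` makes
      -- `B'` dominate the propagation term `J C σ X q` and the source term `J σ X` together.
      set B : ℝ → ℝ := fun t => 1 / 2 * (σ X * (2 * J * t * Real.exp (v * t))
        + 2 * ((2 * b * t) ^ (N + 1) / (N + 1).factorial)) with hBdef
      set B' : ℝ → ℝ := fun t => 1 / 2 * (σ X * (2 * J * Real.exp (v * t)
        + 2 * J * t * (Real.exp (v * t) * v)) + 2 * (2 * b * ((2 * b * t) ^ N / N.factorial)))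
      have hB : ∀ t, HasDerivAt B (B' t) t := by
        intro t
        have h1 : HasDerivAt (fun t => 2 * J * t) (2 * J) t := by
          simpa using (hasDerivAt_id t).const_mul (2 * J)
        have h2 : HasDerivAt (fun t => Real.exp (v * t)) (Real.exp (v * t) * v) t := by
          simpa using ((hasDerivAt_id t).const_mul v).exp
        have h3 : HasDerivAt (fun t => 2 * b * t) (2 * b) t := by
          simpa using (hasDerivAt_id t).const_mul (2 * b)
        have h4 := (h3.pow (N + 1)).div_const ((N + 1).factorial : ℝ)
        have h5 := (((h1.mul h2).const_mul (σ X)).add (h4.const_mul 2)).const_mul (1 / 2)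
        refine h5.congr_deriv ?_
        simp only [B', Nat.factorial_succ, Nat.cast_mul, Nat.cast_add, Nat.cast_one,
          Nat.add_sub_cancel]
        have : (N.factorial : ℝ) ≠ 0 := by positivity
        field_simp
      have hB0 : B 0 = 0 := by simp [B]
      have := norm_commutator_intertwiner_le_aux hM hX hsa hcomm hA hB0 hB (fun s hs => ?_) ht
      · refine this.trans_eq ?_
        simp only [B]; ring
      · set q := 2 * J * s * Real.exp (v * s) with hq
        set r := 2 * ((2 * b * s) ^ N / N.factorial) with hr
        have hq0 : 0 ≤ q := by positivity
        have hr0 : 0 ≤ r := by positivity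
        calc _ ≤ ∑ Z ∈ surface X M, ‖Ψ Z‖ * (σ Z * q + r) + J * σ X := by
              refine add_le_add (Finset.sum_le_sum fun Z hZ => ?_) (hout X hX)
              exact ih Z (hsurf hZ).1 (Ψ Z) (fun Y _ hY => hcomm Z Y hY) s hs
          _ = (∑ Z ∈ surface X M, ‖Ψ Z‖ * σ Z) * q + (∑ Z ∈ surface X M, ‖Ψ Z‖) * r + J * σ X := by
              rw [Finset.sum_mul, Finset.sum_mul, ← Finset.sum_add_distrib]
              congr 1
              exact Finset.sum_congr rfl fun Z _ => by ring
          _ ≤ J * C * σ X * q + b * r + J * σ X := by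
              gcongr
              · exact hprop X hX
              · exact hrest X
          _ ≤ J * C * σ X * q + b * r + J * Real.exp (v * s) * σ X := by
              have h1 : 1 ≤ Real.exp (v * s) := Real.one_le_exp (by positivity)
              have h2 : J * σ X ≤ Real.exp (v * s) * (J * σ X) :=
                le_mul_of_one_le_left (mul_nonneg hJ0 (hσ0 X)) h1
              linarith
          _ = B' s := by simp only [B', hq, hr, hv]; ring
  have hlim : Filter.Tendsto (fun N : ℕ => ‖A‖ * (σ X * (2 * J * t * Real.exp (v * t))
      + 2 * ((2 * b * t) ^ N / N.factorial))) Filter.atTop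
      (nhds (‖A‖ * (σ X * (2 * J * t * Real.exp (v * t)) + 2 * 0))) :=
    ((FloorSemiring.tendsto_pow_div_factorial_atTop (2 * b * t)).const_mul 2
      |>.const_add _).const_mul _
  have := ge_of_tendsto' hlim fun N => key N X hX A hA t ht
  simpa using this

/-- The propagator `e^{itH} e^{-it(H - V)}`. -/
def propagator (H V : 𝔄) (t : ℝ) : 𝔄 := evol H t * evol (-(H - V)) t

lemma propagator_neg (H V : 𝔄) (t : ℝ) : propagator (-H) (-V) (-t) = propagator H V t := by
  rw [propagator, propagator, evol_neg_neg, ← evol_neg_neg (-(H - V)) t]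
  congr 2
  abel

lemma norm_propagator_le {H V : 𝔄} (hH : IsSelfAdjoint H) (hV : IsSelfAdjoint V) (t : ℝ) :
    ‖propagator H V t‖ ≤ 1 := by
  rw [propagator, norm_evol_mul hH]
  exact norm_evol_le (hH.sub hV).neg t

lemma norm_propagator_sub_one_le_of_nonneg {H V : 𝔄} (hH : IsSelfAdjoint H)
    (hV : IsSelfAdjoint V) {t : ℝ} (ht : 0 ≤ t) : ‖propagator H V t - 1‖ ≤ ‖V‖ * t := by
  have h := norm_evol_prod_sub_one_le (a := H) (b := 0) (c := 0) (d := H - V)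
    (B := fun t => ‖V‖ * t) (B' := fun _ => ‖V‖) hH (hH.sub hV) (by simp)
    (fun s => by simpa using (hasDerivAt_id s).const_mul ‖V‖) (fun s _ => by simp [evol]) ht
  simpa [evol, propagator] using h

lemma norm_propagator_sub_one_le {H V : 𝔄} (hH : IsSelfAdjoint H) (hV : IsSelfAdjoint V)
    (t : ℝ) : ‖propagator H V t - 1‖ ≤ ‖V‖ * |t| := by
  rcases le_total 0 t with ht | ht
  · simpa [abs_of_nonneg ht] using norm_propagator_sub_one_le_of_nonneg hH hV ht
  · simpa [abs_of_nonpos ht, propagator_neg] using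
      norm_propagator_sub_one_le_of_nonneg hH.neg hV.neg (neg_nonneg.2 ht)

/-- The propagator of a perturbation `V` living on `X ⊆ M` is approximated by the propagator in
the volume `M`. -/
theorem norm_propagator_sub_propagator_le {Λ M : Finset Γ} {Ψ : Finset Γ → 𝔄}
    (hM : M ⊆ Λ) (hsa : ∀ Z, IsSelfAdjoint (Ψ Z))
    (hcomm : ∀ Y Z, Disjoint Y Z → Commute (Ψ Y) (Ψ Z)) {F : Γ → Γ → ℝ} {J C : ℝ}
    (hF : ∀ y z, 0 ≤ F y z) (hJ0 : 0 ≤ J) (hC0 : 0 ≤ C)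
    (hJ : ∀ y ∈ Λ, ∀ z ∈ Λ, ∑ Z ∈ Λ.powerset.filter (fun Z => (y ∈ Z ∧ z ∈ Z) ∧ 1 < Z.card), ‖Ψ Z‖
      ≤ J * F y z)
    (hC : ∀ y ∈ Λ, ∀ z ∈ Λ, ∑ u ∈ Λ, F y u * F u z ≤ C * F y z)
    {X : Finset Γ} (hX : X ⊆ M) {V : 𝔄} (hV : IsSelfAdjoint V)
    (hVc : ∀ Z, Z ⊆ Λ → Disjoint X Z → Commute V (Ψ Z)) (t : ℝ) :
    ‖propagator (∑ Z ∈ Λ.powerset, Ψ Z) V t - propagator (∑ Z ∈ M.powerset, Ψ Z) V t‖ ≤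
      ‖V‖ * ((∑ y ∈ X, ∑ z ∈ Λ \ M, F y z) * (2 * J * |t| ^ 2 * Real.exp (2 * J * C * |t|))) := by
  -- Negative times reduce to positive ones on changing the sign of all generators.
  wlog ht : 0 ≤ t generalizing t Ψ V
  · have ht' : 0 ≤ -t := by linarith
    have := this (Ψ := fun Z => -Ψ Z) (fun Z => (hsa Z).neg)
      (fun Y Z h => (hcomm Y Z h).neg_left.neg_right) (by simpa using hJ) hV.neg
      (fun Z hZ hd => (hVc Z hZ hd).neg_left.neg_right) (-t) ht'
    simpa [Finset.sum_neg_distrib, propagator_neg] using this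
  rw [abs_of_nonneg ht]
  set H := ∑ Z ∈ Λ.powerset, Ψ Z with hH
  set K := ∑ Z ∈ M.powerset, Ψ Z with hK
  set σ := ∑ y ∈ X, ∑ z ∈ Λ \ M, F y z
  have hσ0 : 0 ≤ σ := Finset.sum_nonneg fun y _ => Finset.sum_nonneg fun z _ => hF y z
  have hHs : IsSelfAdjoint H := isSelfAdjoint_sum _ fun Z _ => hsa Z
  have hKs : IsSelfAdjoint K := isSelfAdjoint_sum _ fun Z _ => hsa Z
  set v := 2 * J * C
  have hv0 : 0 ≤ v := by positivity
  -- With these four generators the mismatch is `-[V, G]` for the intertwiner `G`, and one time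
  -- integration of the commutator bound gives the power `t ^ 2`.
  have hΩ := norm_evol_prod_sub_one_le (a := H - V) (b := H) (c := K) (d := K - V)
    (B := fun t => ‖V‖ * (σ * (2 * J * t ^ 2 * Real.exp (v * t))))
    (B' := fun t => ‖V‖ * (σ * (2 * J * (2 * t) * Real.exp (v * t)
      + 2 * J * t ^ 2 * (Real.exp (v * t) * v)))) (hHs.sub hV) (hKs.sub hV) (by simp)
    (fun s => by
      have h1 : HasDerivAt (fun t => 2 * J * t ^ 2) (2 * J * (2 * s)) s := by
        simpa using (hasDerivAt_pow 2 s).const_mul (2 * J)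
      have h2 : HasDerivAt (fun t => Real.exp (v * t)) (Real.exp (v * s) * v) s := by
        simpa using ((hasDerivAt_id s).const_mul v).exp
      exact ((h1.mul h2).const_mul σ).const_mul ‖V‖)
    (fun s hs => by
      have h := norm_commutator_intertwiner_le hM hsa hcomm hF hJ0 hC0 hJ hC hX hVc hs
      have e : (H - V - H) * (evol (-H) s * evol K s) + evol (-H) s * evol K s * (K - (K - V))
          = -(V * intertwiner Ψ Λ M s - intertwiner Ψ Λ M s * V) := by
        rw [intertwiner]; noncomm_ring
      rw [e, norm_neg]
      refine h.trans (mul_le_mul_of_nonneg_left (mul_le_mul_of_nonneg_left ?_ hσ0)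
        (norm_nonneg _))
      have h3 : 0 ≤ 2 * J * s * Real.exp (v * s) := by positivity
      have h4 : 0 ≤ 2 * J * s ^ 2 * (Real.exp (v * s) * v) := by positivity
      linarith) ht
  have e : propagator H V t - propagator K V t
      = -(evol H t * (evol (-(H - V)) t * (evol (H - V) t * (evol (-H) t * evol K t)
        * evol (-(K - V)) t - 1))) := by
    have e1 : evol (-(H - V)) t * (evol (H - V) t * (evol (-H) t * evol K t) * evol (-(K - V)) t)
        = evol (-H) t * evol K t * evol (-(K - V)) t := by
      rw [← mul_assoc, ← mul_assoc, evol_neg_mul_evol, one_mul]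
    have e2 : evol H t * (evol (-H) t * evol K t * evol (-(K - V)) t)
        = evol K t * evol (-(K - V)) t := by
      rw [← mul_assoc, ← mul_assoc, evol_mul_evol_neg, one_mul]
    rw [mul_sub, mul_one, e1, mul_sub, e2, propagator, propagator]
    abel
  rw [e, norm_neg, norm_evol_mul hHs, norm_evol_mul (hHs.sub hV).neg]
  exact hΩ

end Locality

/-! ### Cosine polynomials with nonnegative coefficients and the Dolph–Chebyshev window. -/

section CosineSums

/-- The cone of cosine polynomials of degree at most `n` with nonnegative coefficients. -/
def cosCone (n : ℕ) : Submodule ℝ≥0 (ℝ → ℝ) :=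
  Submodule.span ℝ≥0 ((fun (k : ℕ) (θ : ℝ) => Real.cos (k * θ)) '' Set.Icc 0 n)

lemma cos_mem_cosCone {k n : ℕ} (h : k ≤ n) : (fun θ : ℝ => Real.cos (k * θ)) ∈ cosCone n :=
  Submodule.subset_span ⟨k, ⟨Nat.zero_le _, h⟩, rfl⟩

lemma const_mul_mem_cosCone {n : ℕ} {f : ℝ → ℝ} {a : ℝ} (ha : 0 ≤ a) (hf : f ∈ cosCone n) :
    (fun θ => a * f θ) ∈ cosCone n :=
  (cosCone n).smul_mem (⟨a, ha⟩ : ℝ≥0) hf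

/-- Product-to-sum: `2 cos jθ cos kθ = cos (j+k)θ + cos (j-k)θ`. -/
lemma mul_mem_cosCone {m n : ℕ} {f g : ℝ → ℝ} (hf : f ∈ cosCone m) (hg : g ∈ cosCone n) :
    f * g ∈ cosCone (m + n) := by
  have h : cosCone m * cosCone n ≤ cosCone (m + n) := by
    rw [cosCone, cosCone, Submodule.span_mul_span, Submodule.span_le]
    rintro _ ⟨_, ⟨j, hj, rfl⟩, _, ⟨k, hk, rfl⟩, rfl⟩
    have h1 := cos_mem_cosCone (add_le_add hj.2 hk.2)
    have h2 : (fun θ : ℝ => Real.cos (((j : ℝ) - k) * θ)) ∈ cosCone (m + n) := by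
      rcases le_total j k with hjk | hjk
      · have := cos_mem_cosCone (k := k - j) (n := m + n)
          ((Nat.sub_le k j).trans (hk.2.trans (Nat.le_add_left _ _)))
        convert this using 2 with θ
        rw [Nat.cast_sub hjk, ← Real.cos_neg]
        congr 1; ring
      · have := cos_mem_cosCone (k := j - k) (n := m + n)
          ((Nat.sub_le j k).trans (hj.2.trans (Nat.le_add_right _ _)))
        rwa [Nat.cast_sub hjk] at this
    have h3 := const_mul_mem_cosCone (a := 1 / 2) (by norm_num) (Submodule.add_mem _ h1 h2)
    refine (congrArg (· ∈ cosCone (m + n)) (funext fun θ => ?_)).mp h3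
    simp only [Pi.mul_apply, Pi.add_apply, Nat.cast_add, add_mul, sub_mul,
      Real.cos_add, Real.cos_sub]
    ring
  exact h (Submodule.mul_mem_mul hf hg)

lemma cos_pow_mem_cosCone (k : ℕ) : (fun θ : ℝ => Real.cos θ ^ k) ∈ cosCone k := by
  induction k with
  | zero => simpa using cos_mem_cosCone (le_refl 0)
  | succ k ih =>
    have := mul_mem_cosCone ih (cos_mem_cosCone (le_refl 1))
    convert this using 1
    funext θ
    simp [pow_succ]

open Polynomial in
-- Derivatives of `T_n` are combinations of Chebyshev polynomials with natural coefficients, and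
-- `T_m(cos θ) = cos mθ`.
lemma iterate_derivative_chebyshev_mem_cosCone (n k : ℕ) :
    (fun θ : ℝ => (derivative^[k] (Chebyshev.T ℝ n)).eval (Real.cos θ)) ∈ cosCone (n - k) := by
  have h := Chebyshev.T_iterate_derivative_mem_span_T (R := ℝ) n k
  generalize derivative^[k] (Chebyshev.T ℝ n) = p at h ⊢
  induction h using Submodule.span_induction with
  | mem p hp =>
    obtain ⟨m, hm, rfl⟩ := hp
    simpa using cos_mem_cosCone hm.2
  | zero => simp only [eval_zero]; exact Submodule.zero_mem _
  | add p q _ _ hp hq => simp only [eval_add]; exact Submodule.add_mem _ hp hq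
  | smul a p _ hp =>
    simp only [nsmul_eq_mul, eval_mul, eval_natCast]
    exact const_mul_mem_cosCone (Nat.cast_nonneg a) hp

open Polynomial in
-- Taylor expansion at `cos θ` with increment `(α - 1) cos θ`: since `α ≥ 1`, every term is a
-- nonnegative multiple of a product of elements of the cone.
lemma chebyshev_dilate_mem_cosCone (n : ℕ) {α : ℝ} (hα : 1 ≤ α) :
    (fun θ : ℝ => (Chebyshev.T ℝ n).eval (α * Real.cos θ)) ∈ cosCone n := by
  have e : (fun θ : ℝ => (Chebyshev.T ℝ n).eval (α * Real.cos θ))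
      = ∑ k ∈ Finset.range (n + 1), fun θ => ((α - 1) ^ k / k.factorial) *
        ((derivative^[k] (Chebyshev.T ℝ n)).eval (Real.cos θ) * Real.cos θ ^ k) := by
    funext θ
    have h1 : α * Real.cos θ = (α - 1) * Real.cos θ + Real.cos θ := by ring
    have h2 : (taylor (Real.cos θ) (Chebyshev.T ℝ n)).natDegree < n + 1 := by
      rw [natDegree_taylor, Chebyshev.natDegree_T]; simp
    rw [h1, ← taylor_eval, eval_eq_sum_range' h2, Finset.sum_apply]
    refine Finset.sum_congr rfl fun k _ => ?_
    have h3 := congrFun (factorial_smul_hasseDeriv (R := ℝ) k) (Chebyshev.T ℝ n)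
    rw [taylor_coeff, ← h3]
    have h4 : (k.factorial : ℝ) ≠ 0 := by positivity
    rw [LinearMap.smul_apply, eval_smul, nsmul_eq_mul, mul_pow]
    field_simp
  rw [e]
  refine Submodule.sum_mem _ fun k hk => ?_
  refine const_mul_mem_cosCone (by have := sub_nonneg.2 hα; positivity) ?_
  have := mul_mem_cosCone (iterate_derivative_chebyshev_mem_cosCone n k) (cos_pow_mem_cosCone k)
  rwa [Nat.sub_add_cancel (Nat.lt_succ_iff.1 (Finset.mem_range.1 hk))] at this

lemma exists_coeff_of_mem_cosCone {n : ℕ} {f : ℝ → ℝ} (hf : f ∈ cosCone n) :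
    ∃ c : Fin (n + 1) → ℝ, (∀ k, 0 ≤ c k) ∧ ∀ θ, f θ = ∑ k, c k * Real.cos (k * θ) := by
  have e : (fun (k : ℕ) (θ : ℝ) => Real.cos (k * θ)) '' Set.Icc 0 n
      = Set.range fun (k : Fin (n + 1)) (θ : ℝ) => Real.cos (k * θ) := by
    ext g
    constructor
    · rintro ⟨k, hk, rfl⟩
      exact ⟨⟨k, Nat.lt_succ_iff.2 hk.2⟩, rfl⟩
    · rintro ⟨k, rfl⟩
      exact ⟨k, ⟨Nat.zero_le _, Nat.lt_succ_iff.1 k.2⟩, rfl⟩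
  rw [cosCone, e, Submodule.mem_span_range_iff_exists_fun] at hf
  obtain ⟨c, rfl⟩ := hf
  refine ⟨fun k => c k, fun k => (c k).2, fun θ => ?_⟩
  simp [Finset.sum_apply, NNReal.smul_def]

/-- The product decreases from `1`, by `tanh y ≤ y ≤ tan y`. It yields `arcosh (1 / cos x) ≥ x`, so
that the window decays with the full exponent `T r`. -/
lemma cosh_mul_cos_le_one {x : ℝ} (h0 : 0 ≤ x) (h1 : x < Real.pi / 2) :
    Real.cosh x * Real.cos x ≤ 1 := by
  have hd : ∀ y, HasDerivAt (fun y => Real.cosh y * Real.cos y)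
      (Real.sinh y * Real.cos y + Real.cosh y * (-Real.sin y)) y := fun y =>
    (Real.hasDerivAt_cosh y).mul (Real.hasDerivAt_cos y)
  have hanti : AntitoneOn (fun y => Real.cosh y * Real.cos y) (Set.Ico 0 (Real.pi / 2)) := by
    refine antitoneOn_of_deriv_nonpos (convex_Ico _ _)
      (fun y _ => (hd y).continuousAt.continuousWithinAt)
      (fun y _ => (hd y).differentiableAt.differentiableWithinAt) fun y hy => ?_
    rw [interior_Ico] at hy
    rw [(hd y).deriv]
    have hc : 0 < Real.cos y := Real.cos_pos_of_mem_Ioo ⟨by linarith [hy.1, Real.pi_pos], hy.2⟩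
    have h2 : y * Real.cos y ≤ Real.sin y := by
      have := Real.le_tan hy.1.le hy.2
      rwa [Real.tan_eq_sin_div_cos, le_div_iff₀ hc] at this
    have h3 : Real.sinh y ≤ y * Real.cosh y := by
      have hmono : MonotoneOn (fun z => z * Real.cosh z - Real.sinh z) (Set.Ici 0) := by
        have hd' : ∀ z, HasDerivAt (fun z => z * Real.cosh z - Real.sinh z)
            (1 * Real.cosh z + z * Real.sinh z - Real.cosh z) z := fun z =>
          ((hasDerivAt_id z).mul (Real.hasDerivAt_cosh z)).sub (Real.hasDerivAt_sinh z)
        refine monotoneOn_of_deriv_nonneg (convex_Ici _)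
          (fun z _ => (hd' z).continuousAt.continuousWithinAt)
          (fun z _ => (hd' z).differentiableAt.differentiableWithinAt) fun z hz => ?_
        rw [interior_Ici] at hz
        rw [(hd' z).deriv]
        have := mul_nonneg (le_of_lt hz) (Real.sinh_nonneg_iff.2 (le_of_lt hz))
        linarith
      have := hmono Set.self_mem_Ici hy.1.le hy.1.le
      simp at this
      linarith
    have h4 := mul_le_mul_of_nonneg_right h3 hc.le
    have h5 := mul_le_mul_of_nonneg_right h2 (Real.cosh_pos y).le
    nlinarith
  have := hanti ⟨le_rfl, by positivity⟩ ⟨h0, h1⟩ h0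
  simpa using this

/-- The Dolph–Chebyshev window: a cosine sum with frequencies in `[-T, T]` and nonnegative weights
of total mass `1`, which is nonnegative on `[-r, r]` and of order `e^{-T r}` at all points of
`[-B, B]` that are at distance at least `r` from `0`. -/
theorem exists_window {r T B : ℝ} (hr : 0 < r) (hT : 0 < T) :
    ∃ (n : ℕ) (c ν : Fin n → ℝ), (∀ k, 0 ≤ c k) ∧ (∀ k, |ν k| ≤ T) ∧ ∑ k, c k = 1 ∧
      (∀ y, |y| ≤ r → 0 ≤ ∑ k, c k * Real.cos (ν k * y)) ∧
      (∀ y, r ≤ |y| → |y| ≤ B → |∑ k, c k * Real.cos (ν k * y)| ≤ 2 * Real.exp (-(T * r))) := by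
  -- The degree is large enough that the spacing `τ = T / n` keeps `τ y` in the first quarter period
  -- for all relevant `y`, while the frequencies `k τ` stay below `T`.
  obtain ⟨n, hn⟩ := exists_nat_gt (T * (max B r) / (Real.pi / 2))
  have hπ := Real.pi_pos
  have hB : 0 < max B r := lt_max_of_lt_right hr
  have hn0 : (0 : ℝ) < n := lt_of_le_of_lt (by positivity) hn
  rw [div_lt_iff₀ (by positivity)] at hn
  set τ := T / n with hτ
  have hτ0 : 0 < τ := by positivity
  have hnτ : n * τ = T := by rw [hτ]; field_simp
  have hτB : τ * max B r < Real.pi / 2 := by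
    rw [hτ, div_mul_eq_mul_div, div_lt_iff₀ hn0]; linarith
  have hτr : τ * r < Real.pi / 2 :=
    lt_of_le_of_lt (mul_le_mul_of_nonneg_left (le_max_right _ _) hτ0.le) hτB
  have hτr0 : 0 < τ * r := by positivity
  have hc : 0 < Real.cos (τ * r) := Real.cos_pos_of_mem_Ioo ⟨by linarith, hτr⟩
  -- With this dilation `α cos (τ y)` reaches `1` exactly at `|y| = r`: inside, `T_n ≥ 1`; outside,
  -- `|T_n| ≤ 1`, against the peak `T_n(α) = cosh (n arcosh α) ≥ e^{Tr} / 2`.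
  set α := 1 / Real.cos (τ * r) with hα
  have hα1 : 1 ≤ α := by rw [hα, le_div_iff₀ hc]; linarith [Real.cos_le_one (τ * r)]
  obtain ⟨c, hc0, hcs⟩ := exists_coeff_of_mem_cosCone (chebyshev_dilate_mem_cosCone n hα1)
  set N := (Polynomial.Chebyshev.T ℝ n).eval α with hN
  have hN1 : Real.exp (T * r) / 2 ≤ N := by
    have h1 : Real.cosh (τ * r) ≤ α := by
      rw [hα, le_div_iff₀ hc]; exact cosh_mul_cos_le_one hτr0.le hτr
    have h2 : τ * r ≤ Real.arcosh α := by
      have h3 : Real.cosh (τ * r) ≤ Real.cosh (Real.arcosh α) := by rwa [Real.cosh_arcosh hα1]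
      rw [Real.cosh_le_cosh, abs_of_nonneg hτr0.le, abs_of_nonneg (Real.arcosh_nonneg hα1)] at h3
      exact h3
    have h4 : N = Real.cosh (n * Real.arcosh α) := by
      have := Polynomial.Chebyshev.T_real_cosh (Real.arcosh α) n
      rw [Real.cosh_arcosh hα1] at this
      rw [hN, this]; simp
    have h5 : T * r ≤ n * Real.arcosh α := by
      rw [← hnτ, mul_assoc]; exact mul_le_mul_of_nonneg_left h2 hn0.le
    rw [h4, Real.cosh_eq]
    have h6 := Real.exp_le_exp.2 h5
    have h7 := Real.exp_pos (-(n * Real.arcosh α))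
    linarith
  have hN0 : 0 < N := lt_of_lt_of_le (by positivity) hN1
  have hsum : ∀ y, ∑ k : Fin (n + 1), c k / N * Real.cos (k * τ * y)
      = (Polynomial.Chebyshev.T ℝ n).eval (α * Real.cos (τ * y)) / N := by
    intro y
    rw [hcs (τ * y), Finset.sum_div]
    exact Finset.sum_congr rfl fun k _ => by rw [mul_assoc]; ring
  refine ⟨n + 1, fun k => c k / N, fun k => k * τ, fun k => div_nonneg (hc0 k) hN0.le,
    fun k => ?_, ?_, fun y hy => ?_, fun y hy hyB => ?_⟩
  · rw [abs_of_nonneg (by positivity), ← hnτ]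
    exact mul_le_mul_of_nonneg_right (by exact_mod_cast Nat.lt_succ_iff.1 k.2) hτ0.le
  · have := hsum 0
    simp only [mul_zero, Real.cos_zero, mul_one] at this
    rw [this, ← hN, div_self hN0.ne']
  · rw [hsum]
    refine div_nonneg (zero_le_one.trans (Polynomial.Chebyshev.one_le_eval_T_real n ?_)) hN0.le
    rw [hα, div_mul_eq_mul_div, one_mul, le_div_iff₀ hc, one_mul, ← Real.cos_abs (τ * y), abs_mul,
      abs_of_pos hτ0]
    exact Real.cos_le_cos_of_nonneg_of_le_pi (by positivity) (by linarith)
      (mul_le_mul_of_nonneg_left hy hτ0.le)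
  · rw [hsum, abs_div, abs_of_pos hN0]
    have h1 : τ * |y| < Real.pi / 2 := lt_of_le_of_lt
      (mul_le_mul_of_nonneg_left (hyB.trans (le_max_left _ _)) hτ0.le) hτB
    have h2 : |(Polynomial.Chebyshev.T ℝ n).eval (α * Real.cos (τ * y))| ≤ 1 := by
      refine Polynomial.Chebyshev.abs_eval_T_real_le_one n ?_
      rw [← Real.cos_abs (τ * y), abs_mul, abs_mul, abs_of_pos hτ0, abs_of_pos
        (zero_lt_one.trans_le hα1), abs_of_nonneg (Real.cos_nonneg_of_mem_Icc
          ⟨by have := mul_nonneg hτ0.le (abs_nonneg y); linarith, h1.le⟩), hα, div_mul_eq_mul_div,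
        one_mul, div_le_one hc]
      exact Real.cos_le_cos_of_nonneg_of_le_pi hτr0.le (by linarith)
        (mul_le_mul_of_nonneg_left hy hτ0.le)
    rw [div_le_iff₀ hN0]
    have h3 : 2 * Real.exp (-(T * r)) * (Real.exp (T * r) / 2) = 1 := by
      rw [Real.exp_neg]; field_simp
    have h4 := mul_le_mul_of_nonneg_left hN1
      (show 0 ≤ 2 * Real.exp (-(T * r)) by positivity)
    linarith

end CosineSums

/-! ### Steps, bands and peaks as finite Fourier sums. -/

section StepFilter

/-- The primitive of `y ↦ cos (ν y)` that vanishes at `0`. -/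
def cosPrimitive (ν y : ℝ) : ℝ := if ν = 0 then y else Real.sin (ν * y) / ν

lemma hasDerivAt_cosPrimitive (ν y : ℝ) :
    HasDerivAt (cosPrimitive ν) (Real.cos (ν * y)) y := by
  by_cases h : ν = 0
  · have e : cosPrimitive ν = fun y => y := by funext y; simp [cosPrimitive, h]
    rw [e]; simpa [h] using hasDerivAt_id' y
  · have e : cosPrimitive ν = fun y => Real.sin (ν * y) / ν := by funext y; simp [cosPrimitive, h]
    rw [e]
    refine (((hasDerivAt_id y).const_mul ν).sin.div_const ν).congr_deriv ?_
    simp; field_simp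

lemma cosPrimitive_neg (ν y : ℝ) : cosPrimitive ν (-y) = -cosPrimitive ν y := by
  unfold cosPrimitive
  split_ifs
  · rfl
  · rw [mul_neg, Real.sin_neg, neg_div]

/-- Symmetric averaging only rescales the weight of each frequency, so smoothing introduces no new
times. -/
lemma cosPrimitive_sub_add_add (ν y u : ℝ) :
    cosPrimitive ν (y - u) + cosPrimitive ν (y + u) = 2 * Real.cos (ν * u) * cosPrimitive ν y := by
  unfold cosPrimitive
  split_ifs with h
  · simp [h]; ring
  · rw [mul_sub, mul_add, Real.sin_sub, Real.sin_add]; ring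

/-- The Fourier transform of a triangle is the Fejér kernel `(1 - cos νρ) / ν²`; smoothing with it
keeps the weights nonnegative. -/
lemma integral_triangle_mul_cos_nonneg {ρ : ℝ} (hρ : 0 < ρ) (ν : ℝ) :
    0 ≤ ∫ u in (0 : ℝ)..ρ, (ρ - u) * Real.cos (ν * u) := by
  by_cases h : ν = 0
  · refine intervalIntegral.integral_nonneg hρ.le fun u hu => ?_
    simp [h]; exact hu.2
  · have hd : ∀ u ∈ Set.uIcc 0 ρ, HasDerivAt
        (fun u => (ρ - u) * (Real.sin (ν * u) / ν) - Real.cos (ν * u) / ν ^ 2)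
        ((ρ - u) * Real.cos (ν * u)) u := by
      intro u _
      have h1 : HasDerivAt (fun u => ν * u) ν u := by simpa using (hasDerivAt_id u).const_mul ν
      have h2 := (((hasDerivAt_id u).const_sub ρ).mul (h1.sin.div_const ν)).sub
        (h1.cos.div_const (ν ^ 2))
      refine h2.congr_deriv ?_
      simp only [id]
      field_simp
      ring
    rw [intervalIntegral.integral_eq_sub_of_hasDerivAt hd
      (Continuous.intervalIntegrable (by fun_prop) _ _)]
    have h1 := Real.cos_le_one (ν * ρ)
    have h2 : (ρ - ρ) * (Real.sin (ν * ρ) / ν) - Real.cos (ν * ρ) / ν ^ 2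
      - ((ρ - 0) * (Real.sin (ν * 0) / ν) - Real.cos (ν * 0) / ν ^ 2)
        = (1 - Real.cos (ν * ρ)) / ν ^ 2 := by simp; ring
    rw [h2]
    exact div_nonneg (by linarith) (by positivity)

/-- The indicator function of the positive reals. -/
def heaviside (y : ℝ) : ℝ := if 0 < y then 1 else 0

/-- If `P` increases by `1` over `[-r, r]` and is flat outside, it is close to a step. -/
lemma abs_sub_heaviside_le {P φ : ℝ → ℝ} {r B δ : ℝ} (hr : 0 < r)
    (hP : ∀ y, HasDerivAt P (φ y) y) (hφ : ∀ y, r ≤ |y| → |y| ≤ B → |φ y| ≤ δ)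
    (h1 : P r - P (-r) = 1) {y₁ y₂ : ℝ} (hy₁ : r ≤ |y₁|) (hy₁' : |y₁| ≤ B)
    (hy₂ : r ≤ |y₂|) (hy₂' : |y₂| ≤ B) :
    |(P y₂ - P y₁) - (heaviside y₂ - heaviside y₁)| ≤ δ * |y₂ - y₁| := by
  wlog h : y₁ ≤ y₂ generalizing y₁ y₂
  · have := this hy₂ hy₂' hy₁ hy₁' (le_of_not_ge h)
    rw [abs_sub_comm y₁ y₂] at this
    refine le_trans (le_of_eq ?_) this
    rw [← abs_neg]; congr 1; ring
  have seg : ∀ {a b : ℝ}, a ≤ b → (∀ y ∈ Set.Icc a b, r ≤ |y| ∧ |y| ≤ B) →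
      |P b - P a| ≤ δ * (b - a) := by
    intro a b hab hy
    have := Convex.norm_image_sub_le_of_norm_hasDerivWithin_le (f := P) (f' := φ) (C := δ)
      (s := Set.Icc a b) (fun y _ => (hP y).hasDerivWithinAt)
      (fun y hy' => hφ y (hy y hy').1 (hy y hy').2) (convex_Icc a b)
      (Set.left_mem_Icc.2 hab) (Set.right_mem_Icc.2 hab)
    rwa [Real.norm_eq_abs, Real.norm_eq_abs, abs_of_nonneg (sub_nonneg.2 hab)] at this
  have hB1 := abs_le.1 hy₁'
  have hB2 := abs_le.1 hy₂'
  rw [abs_of_nonneg (sub_nonneg.2 h)]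
  rcases le_abs.1 hy₁ with a1 | a1
  · have s := seg h fun y hy => ⟨le_abs.2 (Or.inl (a1.trans hy.1)),
      abs_le.2 ⟨by linarith [hy.1], by linarith [hy.2]⟩⟩
    have e1 : heaviside y₁ = 1 := if_pos (by linarith)
    have e2 : heaviside y₂ = 1 := if_pos (by linarith)
    rwa [e1, e2, sub_self, sub_zero]
  · have e1 : heaviside y₁ = 0 := if_neg (by linarith)
    rcases le_abs.1 hy₂ with a2 | a2
    · have e2 : heaviside y₂ = 1 := if_pos (by linarith)
      have s1 := seg (a := y₁) (b := -r) (by linarith) fun y hy =>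
        ⟨le_abs.2 (Or.inr (by linarith [hy.2])), abs_le.2 ⟨by linarith [hy.1], by linarith [hy.2]⟩⟩
      have s2 := seg (a := r) (b := y₂) a2 fun y hy =>
        ⟨le_abs.2 (Or.inl hy.1), abs_le.2 ⟨by linarith [hy.1], by linarith [hy.2]⟩⟩
      have hδ : 0 ≤ δ := (abs_nonneg _).trans (hφ y₂ hy₂ hy₂')
      have e : (P y₂ - P y₁) - (heaviside y₂ - heaviside y₁)
          = (P y₂ - P r) + (P (-r) - P y₁) := by rw [e1, e2]; linarith
      -- Across the jump, `[-r, r]` is cut out: `P` gains exactly `1` there, as does the step.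
      rw [e]
      refine (abs_add_le _ _).trans ((add_le_add s2 s1).trans ?_)
      nlinarith
    · have s := seg h fun y hy => ⟨le_abs.2 (Or.inr (by linarith [hy.2])),
        abs_le.2 ⟨by linarith [hy.1], by linarith [hy.2]⟩⟩
      have e2 : heaviside y₂ = 0 := if_neg (by linarith)
      rwa [e1, e2, sub_self, sub_zero]

/-- Cosine sums with frequencies in `[-T, T]` whose primitive is close to a step of width `r + ρ`,
with total mass bounded by `1 / ρ` uniformly in `T`. -/
theorem exists_smooth_step {r ρ T B : ℝ} (hr : 0 < r) (hρ : 0 < ρ) (hρr : ρ ≤ r) (hT : 0 < T) :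
    ∃ (n : ℕ) (c ν : Fin n → ℝ), (∀ k, 0 ≤ c k) ∧ (∀ k, |ν k| ≤ T) ∧ ∑ k, c k ≤ 1 / ρ ∧
      ∀ y₁ y₂, r + ρ ≤ |y₁| → |y₁| ≤ B → r + ρ ≤ |y₂| → |y₂| ≤ B →
        |∑ k, c k * (cosPrimitive (ν k) y₂ - cosPrimitive (ν k) y₁)
          - (heaviside y₂ - heaviside y₁)| ≤
          (1 / r + T) * (2 * Real.exp (-(T * r))) * |y₂ - y₁| := by
  -- The margin `ρ` allows for the shifts in the averaging below.
  obtain ⟨n, c, ν, hc, hν, hsum, hpos, hsmall⟩ := exists_window (B := B + ρ) hr hT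
  set φ : ℝ → ℝ := fun y => ∑ k, c k * Real.cos (ν k * y) with hφ
  set P : ℝ → ℝ := fun y => ∑ k, c k * cosPrimitive (ν k) y with hP
  have hPd : ∀ y, HasDerivAt P (φ y) y := fun y =>
    HasDerivAt.fun_sum fun k _ => (hasDerivAt_cosPrimitive (ν k) y).const_mul (c k)
  have hPc : Continuous P := continuous_iff_continuousAt.2 fun y => (hPd y).continuousAt
  have hPodd : ∀ y, P (-y) = -P y := fun y => by
    simp only [hP, cosPrimitive_neg, mul_neg, Finset.sum_neg_distrib]
  have hmono : MonotoneOn P (Set.Icc (-r) r) := by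
    refine monotoneOn_of_deriv_nonneg (convex_Icc _ _)
      (fun y _ => (hPd y).continuousAt.continuousWithinAt)
      (fun y _ => (hPd y).differentiableAt.differentiableWithinAt) fun y hy => ?_
    rw [interior_Icc] at hy
    rw [(hPd y).deriv]
    exact hpos y (abs_le.2 ⟨hy.1.le, hy.2.le⟩)
  -- For `|y| ≤ 1/T` every cosine is at least `1/2`, so `P` rises by at least `r'` over `[-r', r']`,
  -- which bounds the normalisation `1/Z`.
  set r' := min r (1 / T) with hr'
  have hr'0 : 0 < r' := lt_min hr (by positivity)
  have hr'r : r' ≤ r := min_le_left _ _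
  set Z := P r - P (-r) with hZ
  have hZr : r' ≤ Z := by
    have h1 := Convex.mul_sub_le_image_sub_of_le_deriv (convex_Icc (-r') r')
      (f := P) hPc.continuousOn (fun y _ => (hPd y).differentiableAt.differentiableWithinAt)
      (C := 1 / 2) (fun y hy => by
        rw [interior_Icc] at hy
        rw [(hPd y).deriv]
        calc (1 : ℝ) / 2 = ∑ k, c k * (1 / 2) := by rw [← Finset.sum_mul, hsum, one_mul]
          _ ≤ φ y := by
            refine Finset.sum_le_sum fun k _ => mul_le_mul_of_nonneg_left ?_ (hc k)
            have h2 : |ν k * y| ≤ 1 := by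
              rw [abs_mul]
              calc _ ≤ T * (1 / T) := mul_le_mul (hν k)
                    ((abs_le.2 ⟨hy.1.le, hy.2.le⟩).trans (min_le_right _ _)) (abs_nonneg _) hT.le
                _ = 1 := by field_simp
            have h3 := Real.one_sub_sq_div_two_le_cos (x := ν k * y)
            have h4 := (sq_le_one_iff_abs_le_one _).2 h2
            linarith) (-r') (Set.left_mem_Icc.2 (by linarith)) r'
        (Set.right_mem_Icc.2 (by linarith)) (by linarith)
    have h2 := hmono (a := r') (b := r) ⟨by linarith, hr'r⟩ ⟨by linarith, le_rfl⟩ hr'r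
    have h3 := hmono (a := -r) (b := -r') ⟨le_rfl, by linarith⟩ ⟨by linarith, by linarith⟩
      (by linarith)
    rw [hZ]; linarith
  have hZ0 : 0 < Z := hr'0.trans_le hZr
  have hZinv : 1 / Z ≤ 1 / r + T := by
    refine (one_div_le_one_div_of_le hr'0 hZr).trans ?_
    rcases min_choice r (1 / T) with h | h
    · rw [hr', h]; linarith
    · rw [hr', h, one_div_one_div]; have : 0 < 1 / r := by positivity
      linarith
  set δ := (1 / r + T) * (2 * Real.exp (-(T * r))) with hδ
  have hstep : ∀ y₁ y₂, r ≤ |y₁| → |y₁| ≤ B + ρ → r ≤ |y₂| → |y₂| ≤ B + ρ →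
      |(P y₂ / Z - P y₁ / Z) - (heaviside y₂ - heaviside y₁)| ≤ δ * |y₂ - y₁| := by
    intro y₁ y₂ a1 a2 a3 a4
    refine abs_sub_heaviside_le (P := fun y => P y / Z) (φ := fun y => φ y / Z) hr
      (fun y => (hPd y).div_const Z) (fun y hy hy' => ?_) ?_ a1 a2 a3 a4
    · rw [abs_div, abs_of_pos hZ0, div_eq_mul_one_div, mul_comm]
      exact mul_le_mul hZinv (hsmall y hy hy') (abs_nonneg _) (by positivity)
    · rw [← sub_div, ← hZ, div_self hZ0.ne']
  -- Fourier transform of the normalised triangle on `[-ρ, ρ]`. Without this smoothing the total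
  -- weight is only known to be at most `1/Z`, which is bounded here by `1/r + T`.
  set m : ℝ → ℝ := fun ν => 2 / ρ ^ 2 * ∫ u in (0 : ℝ)..ρ, (ρ - u) * Real.cos (ν * u) with hm
  have hm0 : ∀ ν, 0 ≤ m ν := fun ν =>
    mul_nonneg (by positivity) (integral_triangle_mul_cos_nonneg hρ ν)
  -- the averaged primitive
  have havg : ∀ y, ∑ k, c k / Z * m (ν k) * cosPrimitive (ν k) y
      = 1 / ρ ^ 2 * ∫ u in (0 : ℝ)..ρ, (ρ - u) * (P (y - u) / Z + P (y + u) / Z) := by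
    intro y
    have e : ∀ u, (ρ - u) * (P (y - u) / Z + P (y + u) / Z)
        = ∑ k, (c k / Z * 2 * cosPrimitive (ν k) y) * ((ρ - u) * Real.cos (ν k * u)) := by
      intro u
      rw [← add_div, hP]
      simp only
      rw [← Finset.sum_add_distrib, Finset.sum_div, Finset.mul_sum]
      refine Finset.sum_congr rfl fun k _ => ?_
      rw [← mul_add, cosPrimitive_sub_add_add]; ring
    simp_rw [e]
    rw [intervalIntegral.integral_finsetSum fun k _ =>
      Continuous.intervalIntegrable (by fun_prop) _ _, Finset.mul_sum]
    refine Finset.sum_congr rfl fun k _ => ?_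
    rw [intervalIntegral.integral_const_mul, hm]; ring
  have hρint : ∫ u in (0 : ℝ)..ρ, (ρ - u) = ρ ^ 2 / 2 := by
    rw [intervalIntegral.integral_sub (by simp) (by simp), integral_id]; simp; ring
  refine ⟨n, fun k => c k / Z * m (ν k), ν, fun k => mul_nonneg (div_nonneg (hc k) hZ0.le) (hm0 _),
    hν, ?_, ?_⟩
  -- The total weight is the smoothed density at `0`. As `φ ≥ 0` on `[0, ρ]`, it is at most `2/(ρZ)`
  -- times the increment of `P` there, and that is at most `Z/2` because `P` is odd.
  · have e : ∑ k, c k / Z * m (ν k) = 2 / ρ ^ 2 / Z * ∫ u in (0 : ℝ)..ρ, (ρ - u) * φ u := by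
      have e1 : ∀ u, (ρ - u) * φ u = ∑ k, c k * ((ρ - u) * Real.cos (ν k * u)) := by
        intro u; rw [hφ, Finset.mul_sum]; exact Finset.sum_congr rfl fun k _ => by ring
      simp_rw [e1]
      rw [intervalIntegral.integral_finsetSum fun k _ =>
        Continuous.intervalIntegrable (by fun_prop) _ _, Finset.mul_sum]
      refine Finset.sum_congr rfl fun k _ => ?_
      rw [intervalIntegral.integral_const_mul, hm]; ring
    have hφc : Continuous φ := by fun_prop
    have h1 : ∫ u in (0 : ℝ)..ρ, (ρ - u) * φ u ≤ ∫ u in (0 : ℝ)..ρ, ρ * φ u := by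
      refine intervalIntegral.integral_mono_on hρ.le
        (Continuous.intervalIntegrable (by fun_prop) _ _)
        (Continuous.intervalIntegrable (by fun_prop) _ _) fun u hu => ?_
      have := hpos u (abs_le.2 ⟨by linarith [hu.1], hu.2.trans hρr⟩)
      exact mul_le_mul_of_nonneg_right (by linarith [hu.1]) this
    rw [intervalIntegral.integral_const_mul, intervalIntegral.integral_eq_sub_of_hasDerivAt
      (fun u _ => hPd u) (hφc.intervalIntegrable _ _)] at h1
    have hP0 : P 0 = 0 := by have := hPodd 0; rw [neg_zero] at this; linarith
    have h2 : P ρ ≤ P r := hmono ⟨by linarith, hρr⟩ ⟨by linarith, le_rfl⟩ hρr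
    have h3 : P r = Z / 2 := by rw [hZ, hPodd]; ring
    rw [e]
    calc _ ≤ 2 / ρ ^ 2 / Z * (ρ * (Z / 2)) := by
          refine mul_le_mul_of_nonneg_left (h1.trans ?_) (by positivity)
          exact mul_le_mul_of_nonneg_left (by linarith) hρ.le
      _ = 1 / ρ := by field_simp
  · intro y₁ y₂ a1 a2 a3 a4
    have hint : ∀ y, IntervalIntegrable (fun u => (ρ - u) * (P (y - u) / Z + P (y + u) / Z))
        MeasureTheory.volume 0 ρ := fun y => Continuous.intervalIntegrable (by fun_prop) _ _
    have e : ∑ k, c k / Z * m (ν k) * (cosPrimitive (ν k) y₂ - cosPrimitive (ν k) y₁)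
        - (heaviside y₂ - heaviside y₁) = 1 / ρ ^ 2 * ∫ u in (0 : ℝ)..ρ, (ρ - u) *
          (((P (y₂ - u) / Z - P (y₁ - u) / Z) - (heaviside y₂ - heaviside y₁))
          + ((P (y₂ + u) / Z - P (y₁ + u) / Z) - (heaviside y₂ - heaviside y₁))) := by
      simp_rw [mul_sub]
      rw [Finset.sum_sub_distrib, havg, havg]
      have e1 : heaviside y₂ - heaviside y₁ = 1 / ρ ^ 2 * ∫ u in (0 : ℝ)..ρ, (ρ - u) *
          (2 * (heaviside y₂ - heaviside y₁)) := by
        rw [intervalIntegral.integral_mul_const, hρint]; field_simp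
      conv_lhs => rw [e1]
      rw [← mul_sub, ← mul_sub, ← intervalIntegral.integral_sub (hint _) (hint _),
        ← intervalIntegral.integral_sub ((hint _).sub (hint _))
          (Continuous.intervalIntegrable (by fun_prop) _ _)]
      congr 1
      refine intervalIntegral.integral_congr fun u _ => ?_
      ring
    rw [e, abs_mul, abs_of_pos (by positivity : 0 < 1 / ρ ^ 2)]
    have hb : |∫ u in (0 : ℝ)..ρ, (ρ - u) *
          (((P (y₂ - u) / Z - P (y₁ - u) / Z) - (heaviside y₂ - heaviside y₁))
          + ((P (y₂ + u) / Z - P (y₁ + u) / Z) - (heaviside y₂ - heaviside y₁)))|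
        ≤ ∫ u in (0 : ℝ)..ρ, (ρ - u) * (2 * (δ * |y₂ - y₁|)) := by
      rw [← Real.norm_eq_abs]
      refine intervalIntegral.norm_integral_le_of_norm_le hρ.le
        (Filter.Eventually.of_forall fun u hu => ?_)
        (Continuous.intervalIntegrable (by fun_prop) _ _)
      have hu0 : 0 ≤ ρ - u := sub_nonneg.2 hu.2
      rw [Real.norm_eq_abs, abs_mul, abs_of_nonneg hu0]
      refine mul_le_mul_of_nonneg_left ((abs_add_le _ _).trans ?_) hu0
      have shift : ∀ s : ℝ, |s| ≤ ρ →
          |(P (y₂ + s) / Z - P (y₁ + s) / Z) - (heaviside y₂ - heaviside y₁)|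
            ≤ δ * |y₂ - y₁| := by
        intro s hs
        have hh : ∀ y, r + ρ ≤ |y| → |y| ≤ B →
            r ≤ |y + s| ∧ |y + s| ≤ B + ρ ∧ heaviside (y + s) = heaviside y := by
          intro y h1 h2
          have h3 := abs_sub_abs_le_abs_sub y (-s)
          rw [abs_neg, sub_neg_eq_add] at h3
          refine ⟨by linarith, (abs_add_le _ _).trans (by linarith), ?_⟩
          have hs' := abs_le.1 hs
          unfold heaviside
          rcases le_abs.1 h1 with h | h
          · rw [if_pos (by linarith), if_pos (by linarith)]
          · rw [if_neg (by linarith), if_neg (by linarith)]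
        obtain ⟨b1, b2, b3⟩ := hh y₁ a1 a2
        obtain ⟨b4, b5, b6⟩ := hh y₂ a3 a4
        have := hstep _ _ b1 b2 b4 b5
        rwa [b3, b6, add_sub_add_right_eq_sub] at this
      have s1 := shift (-u) (by rw [abs_neg, abs_of_pos hu.1]; exact hu.2)
      have s2 := shift u (by rw [abs_of_pos hu.1]; exact hu.2)
      simp only [← sub_eq_add_neg] at s1
      linarith
    rw [intervalIntegral.integral_mul_const, hρint] at hb
    calc _ ≤ 1 / ρ ^ 2 * (ρ ^ 2 / 2 * (2 * (δ * |y₂ - y₁|))) :=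
          mul_le_mul_of_nonneg_left hb (by positivity)
      _ = δ * |y₂ - y₁| := by field_simp

/-- The Fourier weight of the difference of the steps at `E - p` and `E - q`. -/
def bandWeight (p q ν : ℝ) : ℂ :=
  (Complex.exp (Complex.I * (ν * p : ℝ)) - Complex.exp (Complex.I * (ν * q : ℝ)))
    / (2 * Complex.I * ν)

lemma norm_bandWeight_mul_le (p q ν : ℝ) : ‖bandWeight p q ν‖ * |ν| ≤ 1 := by
  by_cases h : ν = 0
  · simp [h]
  have h1 : ‖Complex.exp (Complex.I * (ν * p : ℝ)) - Complex.exp (Complex.I * (ν * q : ℝ))‖ ≤ 2 := by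
    refine (norm_sub_le _ _).trans ?_
    rw [mul_comm Complex.I, mul_comm Complex.I, Complex.norm_exp_ofReal_mul_I,
      Complex.norm_exp_ofReal_mul_I]
    norm_num
  have h2 : 0 < |ν| := abs_pos.2 h
  rw [bandWeight, norm_div, norm_mul, norm_mul, Complex.norm_I, Complex.norm_real, Real.norm_eq_abs]
  simp only [Complex.norm_ofNat, mul_one]
  rw [div_mul_eq_mul_div, div_le_one (by positivity)]
  nlinarith

/-- Writing the sines as exponentials, and subtracting values at `E`, gives terms `e^{±iν(x-E)} - 1`
that vanish at `x = E`. At `ν = 0` the two linear primitives cancel, in accordance with the value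
`0` of `bandWeight` there. -/
lemma bandWeight_add_bandWeight (a b E x ν : ℝ) :
    (((cosPrimitive ν (x - a) - cosPrimitive ν (E - a))
      - (cosPrimitive ν (x - b) - cosPrimitive ν (E - b)) : ℝ) : ℂ)
      = bandWeight (E - a) (E - b) ν * (Complex.exp (Complex.I * (ν * (x - E) : ℝ)) - 1)
        + bandWeight (E - a) (E - b) (-ν)
          * (Complex.exp (Complex.I * (-ν * (x - E) : ℝ)) - 1) := by
  by_cases h : ν = 0
  · simp [h, cosPrimitive, bandWeight]
  have hν : (ν : ℂ) ≠ 0 := by exact_mod_cast h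
  have key : ∀ p : ℝ, ((cosPrimitive ν (x - E + p) - cosPrimitive ν p : ℝ) : ℂ)
      = (Complex.exp (Complex.I * (ν * p : ℝ))
          * (Complex.exp (Complex.I * (ν * (x - E) : ℝ)) - 1)
        - Complex.exp (Complex.I * (-ν * p : ℝ))
          * (Complex.exp (Complex.I * (-ν * (x - E) : ℝ)) - 1)) / (2 * Complex.I * ν) := by
    intro p
    have e1 : Complex.I * ((ν * (x - E + p) : ℝ) : ℂ)
        = Complex.I * ((ν * p : ℝ) : ℂ) + Complex.I * ((ν * (x - E) : ℝ) : ℂ) := by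
      push_cast; ring
    have e2 : Complex.I * ((-ν * (x - E + p) : ℝ) : ℂ)
        = Complex.I * ((-ν * p : ℝ) : ℂ) + Complex.I * ((-ν * (x - E) : ℝ) : ℂ) := by
      push_cast; ring
    have hs : ∀ z : ℝ, ((Real.sin (ν * z) : ℝ) : ℂ)
        = (Complex.exp (Complex.I * (ν * z : ℝ)) - Complex.exp (Complex.I * (-ν * z : ℝ)))
          / (2 * Complex.I) := by
      intro z
      have e3 : Complex.I * ((-ν * z : ℝ) : ℂ) = -(((ν * z : ℝ) : ℂ) * Complex.I) := by
        push_cast; ring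
      rw [Complex.ofReal_sin, Complex.sin, e3, neg_mul, mul_comm Complex.I,
        div_eq_div_iff two_ne_zero (by simp)]
      linear_combination (Complex.exp (-(((ν * z : ℝ) : ℂ) * Complex.I))
        - Complex.exp (((ν * z : ℝ) : ℂ) * Complex.I)) * 2 * Complex.I_sq
    rw [cosPrimitive, cosPrimitive, if_neg h, if_neg h, Complex.ofReal_sub, Complex.ofReal_div,
      Complex.ofReal_div, hs, hs, e1, e2, Complex.exp_add, Complex.exp_add]
    field_simp
    ring
  have ha : x - a = x - E + (E - a) := by ring
  have hb : x - b = x - E + (E - b) := by ring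
  rw [ha, hb, Complex.ofReal_sub, key, key, bandWeight, bandWeight]
  push_cast
  field_simp
  ring

/-- A filter built from evolutions up to time `T` that reproduces the indicator function of
`(a, b)`, up to its value at `E`, away from the end points. -/
theorem exists_band_filter {r ρ T : ℝ} (B a b E : ℝ) (hr : 0 < r) (hρ : 0 < ρ) (hρr : ρ ≤ r)
    (hT : 0 < T) (hEa : r + ρ ≤ |E - a|) (hEb : r + ρ ≤ |E - b|) :
    ∃ (n : ℕ) (w : Fin n × Bool → ℂ) (t : Fin n × Bool → ℝ), (∀ j, |t j| ≤ T) ∧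
      ∑ j, ‖w j‖ * |t j| ≤ 2 / ρ ∧
      ∀ x, |x| ≤ B → r + ρ ≤ |x - a| → r + ρ ≤ |x - b| →
        ‖((heaviside (x - a) - heaviside (x - b) - (heaviside (E - a) - heaviside (E - b)) : ℝ) : ℂ)
          - ∑ j, w j * (Complex.exp (Complex.I * (t j * (x - E) : ℝ)) - 1)‖ ≤
          2 * ((1 / r + T) * (2 * Real.exp (-(T * r)))) * |x - E| := by
  obtain ⟨n, c, ν, hc, hν, hsum, h⟩ :=
    exists_smooth_step (B := max B |E| + |a| + |b|) hr hρ hρr hT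
  refine ⟨n, fun j => c j.1 * bandWeight (E - a) (E - b) (if j.2 then ν j.1 else -ν j.1),
    fun j => if j.2 then ν j.1 else -ν j.1, fun j => ?_, ?_, fun x hx hxa hxb => ?_⟩
  · dsimp only; split_ifs
    · exact hν _
    · rw [abs_neg]; exact hν _
  · calc _ ≤ ∑ j : Fin n × Bool, c j.1 := by
          refine Finset.sum_le_sum fun j _ => ?_
          rw [norm_mul, Complex.norm_real, Real.norm_eq_abs, abs_of_nonneg (hc _), mul_assoc]
          exact mul_le_of_le_one_right (hc _) (norm_bandWeight_mul_le _ _ _)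
      _ = 2 * ∑ k, c k := by
          rw [Fintype.sum_prod_type, Finset.mul_sum]
          exact Finset.sum_congr rfl fun k _ => by simp
      _ ≤ 2 / ρ := by rw [div_eq_mul_one_div]; linarith
  · have e : ∑ j : Fin n × Bool, (c j.1 : ℂ) * bandWeight (E - a) (E - b)
        (if j.2 then ν j.1 else -ν j.1) * (Complex.exp (Complex.I *
          ((if j.2 then ν j.1 else -ν j.1) * (x - E) : ℝ)) - 1)
        = ((∑ k, c k * (cosPrimitive (ν k) (x - a) - cosPrimitive (ν k) (E - a))
          - ∑ k, c k * (cosPrimitive (ν k) (x - b) - cosPrimitive (ν k) (E - b)) : ℝ) : ℂ) := by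
      rw [Fintype.sum_prod_type, ← Finset.sum_sub_distrib, Complex.ofReal_sum]
      refine Finset.sum_congr rfl fun k _ => ?_
      rw [← mul_sub, Complex.ofReal_mul, bandWeight_add_bandWeight]
      simp only [Fintype.sum_bool, if_true, Bool.false_eq_true, if_false]
      ring
    rw [e, ← Complex.ofReal_sub, Complex.norm_real, Real.norm_eq_abs]
    have hb : ∀ y z : ℝ, |y| ≤ max B |E| → |z| ≤ |a| + |b| → |y - z| ≤ max B |E| + |a| + |b| :=
      fun y z h1 h2 => (abs_sub _ _).trans (by linarith)
    have ha' : |a| ≤ |a| + |b| := le_add_of_nonneg_right (abs_nonneg _)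
    have hb' : |b| ≤ |a| + |b| := le_add_of_nonneg_left (abs_nonneg _)
    have h1 := h (E - a) (x - a) hEa (hb _ _ (le_max_right _ _) ha') hxa
      (hb _ _ (hx.trans (le_max_left _ _)) ha')
    have h2 := h (E - b) (x - b) hEb (hb _ _ (le_max_right _ _) hb') hxb
      (hb _ _ (hx.trans (le_max_left _ _)) hb')
    rw [sub_sub_sub_cancel_right] at h1 h2
    have h3 := abs_le.1 h1
    have h4 := abs_le.1 h2
    rw [abs_le]
    constructor <;> linarith [h3.1, h3.2, h4.1, h4.2]

/-- A filter of total weight `1`, built from evolutions up to time `T`, that is `1` at `lam` and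
small at distance at least `r` from `lam`. -/
theorem exists_peak_filter {r T : ℝ} (B lam E : ℝ) (hr : 0 < r) (hT : 0 < T) :
    ∃ (n : ℕ) (w : Fin n × Bool → ℂ) (t : Fin n × Bool → ℝ), (∀ j, |t j| ≤ T) ∧
      ∑ j, ‖w j‖ = 1 ∧ ∑ j, w j * Complex.exp (Complex.I * (t j * (lam - E) : ℝ)) = 1 ∧
      ∀ x, |x| ≤ B → r ≤ |x - lam| →
        ‖∑ j, w j * Complex.exp (Complex.I * (t j * (x - E) : ℝ))‖ ≤ 2 * Real.exp (-(T * r)) := by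
  obtain ⟨n, c, ν, hc, hν, hsum, -, h⟩ := exists_window (B := B + |lam|) hr hT
  set t : Fin n × Bool → ℝ := fun j => if j.2 then ν j.1 else -ν j.1 with ht
  have e : ∀ x, ∑ j, (c j.1 / 2 * Complex.exp (Complex.I * (t j * (E - lam) : ℝ)))
      * Complex.exp (Complex.I * (t j * (x - E) : ℝ))
        = ((∑ k, c k * Real.cos (ν k * (x - lam)) : ℝ) : ℂ) := by
    intro x
    rw [Fintype.sum_prod_type, Complex.ofReal_sum]
    refine Finset.sum_congr rfl fun k _ => ?_
    have e1 : ∀ s : ℝ, Complex.exp (Complex.I * (s * (E - lam) : ℝ))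
        * Complex.exp (Complex.I * (s * (x - E) : ℝ))
        = Complex.exp (((s * (x - lam) : ℝ) : ℂ) * Complex.I) := by
      intro s
      rw [← Complex.exp_add]
      congr 1; push_cast; ring
    simp only [ht, Fintype.sum_bool, if_true, Bool.false_eq_true, if_false, mul_assoc, e1]
    rw [Complex.ofReal_mul (c k), Complex.ofReal_cos, Complex.cos]
    simp only [neg_mul, Complex.ofReal_neg]
    ring
  -- The phases move the centre of the window from `E` to `lam` without changing the absolute values
  -- of the weights.
  refine ⟨n, fun j => c j.1 / 2 * Complex.exp (Complex.I * (t j * (E - lam) : ℝ)), t,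
    fun j => ?_, ?_, ?_, fun x hx hxl => ?_⟩
  · simp only [ht]; split_ifs
    · exact hν _
    · rw [abs_neg]; exact hν _
  · have e2 : ∀ j : Fin n × Bool, ‖(c j.1 / 2 * Complex.exp (Complex.I * (t j * (E - lam) : ℝ)) : ℂ)‖
        = c j.1 / 2 := by
      intro j
      rw [norm_mul, mul_comm Complex.I, Complex.norm_exp_ofReal_mul_I, norm_div, Complex.norm_real,
        Real.norm_eq_abs, abs_of_nonneg (hc _)]
      simp
    simp_rw [e2]
    rw [Fintype.sum_prod_type, ← hsum]
    exact Finset.sum_congr rfl fun k _ => by simp; ring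
  · rw [e]; simp [hsum]
  · rw [e, Complex.norm_real, Real.norm_eq_abs]
    exact h _ hxl ((abs_sub _ _).trans (by linarith))

end StepFilter

/-! ### The embedding `A ↦ A ⊗ 1` and supports. -/

section Embedding

variable {Γ : Type u} [DecidableEq Γ] {d : Γ → ℕ} {X Y M Λ : Finset Γ}

lemma Config.restrict_glue (h : X ⊆ Λ) (σ : Config d Λ) (τ : Config d X) :
    (σ.glue τ).restrict h = τ := by
  funext x
  simp [Config.restrict, Config.glue]

lemma Config.glue_restrict (h : X ⊆ Λ) (σ : Config d Λ) : σ.glue (σ.restrict h) = σ := by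
  funext x
  simp [Config.restrict, Config.glue]

lemma Config.glue_glue (σ : Config d Λ) (τ τ' : Config d X) : (σ.glue τ).glue τ' = σ.glue τ' := by
  funext x
  by_cases hx : (x : Γ) ∈ X <;> simp [Config.glue, hx]

lemma Config.restrict_glue_of_disjoint (hXY : Disjoint X Y) (h : Y ⊆ Λ) (σ : Config d Λ)
    (τ : Config d X) : (σ.glue τ).restrict h = σ.restrict h := by
  funext x
  have hx : (x : Γ) ∉ X := fun hx => Finset.disjoint_left.1 hXY hx x.2
  simp [Config.restrict, Config.glue, hx]

lemma Config.glue_comm_of_disjoint (hXY : Disjoint X Y) (σ : Config d Λ)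
    (τ : Config d X) (τ' : Config d Y) : (σ.glue τ).glue τ' = (σ.glue τ').glue τ := by
  funext x
  by_cases hx : (x : Γ) ∈ X
  · have hy : (x : Γ) ∉ Y := fun hy => Finset.disjoint_left.1 hXY hx hy
    simp [Config.glue, hx, hy]
  · by_cases hy : (x : Γ) ∈ Y <;> simp [Config.glue, hx, hy]

lemma Config.glue_restrict_glue (hX : X ⊆ M) (h : M ⊆ Λ) (σ : Config d Λ) (τ : Config d X) :
    σ.glue ((σ.restrict h).glue τ) = σ.glue τ := by
  funext x
  by_cases hx : (x : Γ) ∈ X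
  · simp [Config.glue, hx, hX hx]
  · by_cases hm : (x : Γ) ∈ M <;> simp [Config.glue, Config.restrict, hx, hm]

/-- The variables in `X` of a vector on `Λ`, for a fixed configuration off `X`. -/
def slice (σ : Config d Λ) (X : Finset Γ) (ψ : HSpace d Λ) : HSpace d X :=
  WithLp.toLp 2 fun τ => ψ (σ.glue τ)

lemma embed_apply (h : X ⊆ Λ) (A : Obs d X) (ψ : HSpace d Λ) (σ : Config d Λ) :
    embed h A ψ σ = A (slice σ X ψ) (σ.restrict h) := rfl

lemma slice_embed (h : X ⊆ Λ) (A : Obs d X) (ψ : HSpace d Λ) (σ : Config d Λ) :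
    slice σ X (embed h A ψ) = A (slice σ X ψ) := by
  ext τ
  change embed h A ψ (σ.glue τ) = _
  rw [embed_apply, Config.restrict_glue]
  simp only [slice, Config.glue_glue]

lemma embed_one (h : X ⊆ Λ) : embed h (1 : Obs d X) = 1 := by
  ext ψ σ
  change ψ (σ.glue (σ.restrict h)) = ψ σ
  rw [Config.glue_restrict]

lemma embed_mul (h : X ⊆ Λ) (A B : Obs d X) : embed h (A * B) = embed h A * embed h B := by
  ext ψ σ
  change embed h (A * B) ψ σ = embed h A (embed h B ψ) σ
  rw [embed_apply, embed_apply, slice_embed]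
  rfl

/-- Exchanging `τ` with the `X`-part of `σ` is an involution of the pairs `(σ, τ)`. -/
lemma sum_sum_glue (h : X ⊆ Λ) (g : Config d Λ → ℂ) :
    ∑ σ : Config d Λ, ∑ τ : Config d X, g (σ.glue τ)
      = Fintype.card (Config d X) * ∑ σ, g σ := by
  have hinv : Function.Involutive
      (fun p : Config d Λ × Config d X => (p.1.glue p.2, p.1.restrict h)) := by
    rintro ⟨σ, τ⟩
    simp only [Config.restrict_glue, Config.glue_glue, Config.glue_restrict]
  rw [← Fintype.sum_prod_type' (f := fun (σ : Config d Λ) (τ : Config d X) => g (σ.glue τ)),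
    Fintype.sum_equiv hinv.toPerm (fun p => g (p.1.glue p.2)) (fun p => g p.1) (fun p => rfl),
    Fintype.sum_prod_type, Finset.mul_sum]
  exact Finset.sum_congr rfl fun σ _ => by simp

/-- Each slice is counted once per configuration on `X`. Adjoints can thus be checked slice by
slice, without factoring off the complement of `X`. -/
lemma card_mul_inner (h : X ⊆ Λ) (φ ψ : HSpace d Λ) :
    Fintype.card (Config d X) * inner ℂ φ ψ
      = ∑ σ : Config d Λ, inner ℂ (slice σ X φ) (slice σ X ψ) := by
  simp only [PiLp.inner_apply]
  rw [← sum_sum_glue h]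
  rfl

lemma embed_star (h : X ⊆ Λ) (A : Obs d X) : embed h (star A) = star (embed h A) := by
  rw [ContinuousLinearMap.star_eq_adjoint (embed h A), ContinuousLinearMap.eq_adjoint_iff]
  intro φ ψ
  by_cases hN : IsEmpty (Config d X)
  · have : IsEmpty (Config d Λ) := ⟨fun σ => hN.elim (σ.restrict h)⟩
    simp only [PiLp.inner_apply, Finset.univ_eq_empty, Finset.sum_empty]
  · have hN' : (Fintype.card (Config d X) : ℂ) ≠ 0 := by
      rw [not_isEmpty_iff] at hN
      exact_mod_cast Fintype.card_ne_zero
    refine mul_left_cancel₀ hN' ?_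
    rw [card_mul_inner h, card_mul_inner h]
    refine Finset.sum_congr rfl fun σ _ => ?_
    rw [slice_embed, slice_embed, ContinuousLinearMap.star_eq_adjoint,
      ContinuousLinearMap.adjoint_inner_left]

/-- `A ↦ A ⊗ 1` as a homomorphism of star algebras. -/
def embedHom (d : Γ → ℕ) (h : X ⊆ Λ) : Obs d X →⋆ₐ[ℂ] Obs d Λ where
  toFun := embed h
  map_one' := embed_one h
  map_mul' := embed_mul h
  map_zero' := rfl
  map_add' _ _ := rfl
  commutes' c := by
    rw [Algebra.algebraMap_eq_smul_one, Algebra.algebraMap_eq_smul_one]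
    have : embed h (c • (1 : Obs d X)) = c • embed h (1 : Obs d X) := rfl
    rw [this, embed_one]
  map_star' := embed_star h

lemma norm_embed_le (h : X ⊆ Λ) (A : Obs d X) : ‖embed h A‖ ≤ ‖A‖ :=
  NonUnitalStarAlgHom.norm_apply_le (embedHom d h) A

lemma isSelfAdjoint_embed (h : X ⊆ Λ) {A : Obs d X} (hA : IsSelfAdjoint A) :
    IsSelfAdjoint (embed h A) := by
  rw [isSelfAdjoint_iff, ← embed_star, hA.star_eq]

lemma embed_embed (hX : X ⊆ M) (h : M ⊆ Λ) (A : Obs d X) :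
    embed h (embed hX A) = embed (hX.trans h) A := by
  ext ψ σ
  rw [embed_apply, embed_apply, embed_apply]
  have : slice (σ.restrict h) X (slice σ M ψ) = slice σ X ψ := by
    ext τ
    change ψ (σ.glue ((σ.restrict h).glue τ)) = ψ (σ.glue τ)
    rw [Config.glue_restrict_glue hX h]
  rw [this]
  rfl

lemma apply_eq_sum_single (A : Obs d X) (v : HSpace d X) (τ₀ : Config d X) :
    A v τ₀ = ∑ τ, v τ * A (EuclideanSpace.single τ 1) τ₀ := by
  have hv : v = ∑ τ, v τ • EuclideanSpace.single τ (1 : ℂ) := by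
    ext τ
    simp [Finset.sum_apply, Pi.single_apply]
  conv_lhs => rw [hv, map_sum]
  simp

lemma commute_embed (hXY : Disjoint X Y) (hX : X ⊆ Λ) (hY : Y ⊆ Λ) (A : Obs d X) (B : Obs d Y) :
    Commute (embed hX A) (embed hY B) := by
  ext ψ σ
  change embed hX A (embed hY B ψ) σ = embed hY B (embed hX A ψ) σ
  have key : ∀ {X Y : Finset Γ} (_ : Disjoint X Y) (hX : X ⊆ Λ) (hY : Y ⊆ Λ) (A : Obs d X)
      (B : Obs d Y), embed hX A (embed hY B ψ) σ = ∑ τ, ∑ τ', ψ ((σ.glue τ).glue τ')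
        * (B (EuclideanSpace.single τ' 1) (σ.restrict hY)
          * A (EuclideanSpace.single τ 1) (σ.restrict hX)) := by
    intro X Y hXY hX hY A B
    rw [embed_apply, apply_eq_sum_single]
    refine Finset.sum_congr rfl fun τ _ => ?_
    change embed hY B ψ (σ.glue τ) * _ = _
    rw [embed_apply, apply_eq_sum_single, Config.restrict_glue_of_disjoint hXY, Finset.sum_mul]
    exact Finset.sum_congr rfl fun τ' _ => mul_assoc _ _ _
  rw [key hXY hX hY, key hXY.symm hY hX, Finset.sum_comm]
  refine Finset.sum_congr rfl fun τ _ => Finset.sum_congr rfl fun τ' _ => ?_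
  rw [Config.glue_comm_of_disjoint hXY, mul_comm (B _ _)]

lemma embed_evol (h : X ⊆ Λ) (A : Obs d X) (t : ℝ) : embed h (evol A t) = evol (embed h A) t := by
  let _ : NormedAlgebra ℚ (Obs d X) := NormedAlgebra.restrictScalars ℚ ℝ (Obs d X)
  let _ : NormedAlgebra ℚ (Obs d Λ) := NormedAlgebra.restrictScalars ℚ ℝ (Obs d Λ)
  have hc : Continuous (embedHom d h) :=
    (embedHom d h).toAlgHom.toLinearMap.continuous_of_finiteDimensional
  exact NormedSpace.map_exp (embedHom d h) hc _

lemma isSupportedIn_iff (h : X ⊆ Λ) {A : Obs d Λ} :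
    IsSupportedIn X A ↔ A ∈ (embedHom d h).toAlgHom.range :=
  ⟨fun ⟨_, B, hB⟩ => ⟨B, hB.symm⟩, fun ⟨B, hB⟩ => ⟨h, B, hB.symm⟩⟩

lemma IsSupportedIn.mono (hX : X ⊆ M) (h : M ⊆ Λ) {A : Obs d Λ} (hA : IsSupportedIn X A) :
    IsSupportedIn M A := by
  obtain ⟨h', B, rfl⟩ := hA
  exact ⟨h, embed hX B, (embed_embed hX h B).symm⟩

lemma IsSupportedIn.evol {A : Obs d Λ} (hA : IsSupportedIn X A) (t : ℝ) :
    IsSupportedIn X (SpinSystem.evol A t) := by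
  obtain ⟨h, B, rfl⟩ := hA
  exact ⟨h, SpinSystem.evol B t, (embed_evol h B t).symm⟩

lemma IsSupportedIn.commute (hXY : Disjoint X Y) {A B : Obs d Λ} (hA : IsSupportedIn X A)
    (hB : IsSupportedIn Y B) : Commute A B := by
  obtain ⟨h, A, rfl⟩ := hA
  obtain ⟨h', B, rfl⟩ := hB
  exact commute_embed hXY h h' A B

lemma IsSupportedIn.propagator {H V : Obs d Λ} (hH : IsSupportedIn X H) (hV : IsSupportedIn X V)
    (t : ℝ) : IsSupportedIn X (SpinSystem.propagator H V t) := by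
  have h := hH.choose
  have h1 : IsSupportedIn X (-(H - V)) := by
    rw [isSupportedIn_iff h] at *
    exact neg_mem (sub_mem hH hV)
  have h2 := hH.evol t
  have h3 := h1.evol t
  rw [isSupportedIn_iff h] at *
  exact mul_mem h2 h3

end Embedding

/-! ### Spectral calculus on eigenvectors of the unperturbed operator. -/

section Spectral

variable {E : Type u} [NormedAddCommGroup E] [InnerProductSpace ℂ E]

lemma mem_spectrum_of_apply_eq_smul {H : E →L[ℂ] E} {x : E} {a : ℝ} (hx0 : x ≠ 0)
    (hx : H x = (a : ℂ) • x) : a ∈ spectrum ℝ H := by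
  rw [spectrum.mem_iff]
  rintro ⟨u, hu⟩
  have h1 : (u : E →L[ℂ] E) x = 0 := by
    rw [hu, _root_.sub_apply, hx, Algebra.algebraMap_eq_smul_one,
      _root_.smul_apply, one_apply_eq_self]
    simp
  have h2 : ((↑u⁻¹ : E →L[ℂ] E) * (u : E →L[ℂ] E)) x = x := by rw [Units.inv_mul]; rfl
  rw [mul_apply_eq_comp, h1, map_zero] at h2
  exact hx0 h2.symm

lemma inner_eigenbasis_apply {n : ℕ} (b : OrthonormalBasis (Fin n) ℂ E) {D : E →L[ℂ] E}
    {c : Fin n → ℂ} (hD : ∀ j, D (b j) = c j • b j) (ψ : E) (j : Fin n) :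
    inner ℂ (b j) (D ψ) = c j * inner ℂ (b j) ψ := by
  conv_lhs => rw [← b.sum_repr ψ, map_sum, inner_sum]
  simp only [map_smul, hD, inner_smul_right, orthonormal_iff_ite.1 b.orthonormal,
    b.repr_apply_apply]
  simp [mul_comm]

/-- Since `V ψ = (H - e) ψ`, the coefficients of `V ψ` in the eigenbasis are `(a j - e)` times those
of `ψ`; those of `D ψ` are at most `δ` times as large. -/
lemma norm_apply_le_of_diagonal {H V D : E →L[ℂ] E} {n : ℕ} (b : OrthonormalBasis (Fin n) ℂ E)
    {a : Fin n → ℝ} (hb : ∀ j, H (b j) = (a j : ℂ) • b j) {c : Fin n → ℂ}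
    (hD : ∀ j, D (b j) = c j • b j) {ψ : E} {e δ : ℝ} (hψ : ‖ψ‖ = 1)
    (he : (H - V) ψ = (e : ℂ) • ψ) (hδ : 0 ≤ δ) (hc : ∀ j, ‖c j‖ ≤ δ * |a j - e|) :
    ‖D ψ‖ ≤ δ * ‖V‖ := by
  have hV : V ψ = H ψ - (e : ℂ) • ψ := by
    rw [← he, _root_.sub_apply]; abel
  have hin : ∀ j, ‖inner ℂ (b j) (V ψ)‖ = |a j - e| * ‖inner ℂ (b j) ψ‖ := by
    intro j
    rw [hV, inner_sub_right, inner_eigenbasis_apply b hb, inner_smul_right, ← sub_mul, norm_mul,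
      ← Complex.ofReal_sub, Complex.norm_real, Real.norm_eq_abs]
  have h3 : ‖V ψ‖ ≤ ‖V‖ := by simpa [hψ] using V.le_opNorm ψ
  refine le_trans ?_ (mul_le_mul_of_nonneg_left h3 hδ)
  refine le_of_sq_le_sq ?_ (by positivity)
  rw [mul_pow, ← b.sum_sq_norm_inner_right (D ψ), ← b.sum_sq_norm_inner_right (V ψ),
    Finset.mul_sum]
  refine Finset.sum_le_sum fun j _ => ?_
  rw [← mul_pow, hin, inner_eigenbasis_apply b hD, norm_mul, ← mul_assoc]
  exact pow_le_pow_left₀ (by positivity) (mul_le_mul_of_nonneg_right (hc j) (norm_nonneg _)) 2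

variable [FiniteDimensional ℂ E]

lemma evol_apply_eigenvector {H : E →L[ℂ] E} {x : E} {a : ℝ} (hx : H x = (a : ℂ) • x) (t : ℝ) :
    evol H t x = Complex.exp (Complex.I * (t * a : ℝ)) • x := by
  set f : ℝ → E := fun s => Complex.exp (-(Complex.I * (s * a : ℝ))) • evol H s x with hf
  have hd : ∀ s, HasDerivAt f 0 s := by
    intro s
    have h1 : HasDerivAt (fun s : ℝ => evol H s x) ((evol H s * (Complex.I • H)) x) s :=
      ((ContinuousLinearMap.apply ℂ E x).restrictScalars ℝ).hasFDerivAt.comp_hasDerivAt s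
        (hasDerivAt_evol H s)
    have h2 : HasDerivAt (fun s : ℝ => -(Complex.I * (s * a : ℝ))) (-(Complex.I * a)) s := by
      have : HasDerivAt (fun s : ℝ => ((s * a : ℝ) : ℂ)) (a : ℂ) s := by
        have h := ((hasDerivAt_id s).mul_const a).ofReal_comp
        simpa using h
      exact (this.const_mul Complex.I).neg
    refine (h2.cexp.smul h1).congr_deriv ?_
    simp only [mul_apply_eq_comp, _root_.smul_apply, hx, map_smul,
      smul_smul]
    rw [← add_smul]
    convert zero_smul ℂ _ using 2
    ring
  have hc : f t = f 0 := is_const_of_deriv_eq_zero (fun s => (hd s).differentiableAt)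
    (fun s => (hd s).deriv) t 0
  have h0 : f 0 = x := by simp [hf, evol_zero]
  have : evol H t x = Complex.exp (Complex.I * (t * a : ℝ)) • f t := by
    rw [hf, smul_smul, ← Complex.exp_add, add_neg_cancel, Complex.exp_zero, one_smul]
  rw [this, hc, h0]

/-- The right factor of the propagator is a phase on `ψ`. This turns functions of `H` into
combinations of propagators. -/
lemma propagator_apply_eigenvector {H V : E →L[ℂ] E} {ψ : E} {a : ℝ}
    (hψ : (H - V) ψ = (a : ℂ) • ψ) (t : ℝ) :
    propagator H V t ψ = Complex.exp (-(Complex.I * (t * a : ℝ))) • evol H t ψ := by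
  have h : (-(H - V)) ψ = ((-a : ℝ) : ℂ) • ψ := by
    rw [_root_.neg_apply, hψ]; simp
  rw [propagator, mul_apply_eq_comp, evol_apply_eigenvector h, map_smul]
  congr 2
  push_cast; ring

lemma sectorProj_apply_of_mem {H : E →L[ℂ] E} {S : Set ℝ} {x : E} {a : ℝ}
    (hx : H x = (a : ℂ) • x) (ha : a ∈ S) : sectorProj H S x = x := by
  rw [sectorProj, Submodule.starProjection_eq_self_iff]
  exact Submodule.mem_iSup_of_mem a (Submodule.mem_iSup_of_mem ha
    (Module.End.mem_eigenspace_iff.2 hx))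

lemma sectorProj_apply_of_notMem {H : E →L[ℂ] E} (hH : IsSelfAdjoint H) {S : Set ℝ} {x : E} {a : ℝ}
    (hx : H x = (a : ℂ) • x) (ha : a ∉ S) : sectorProj H S x = 0 := by
  rw [sectorProj, Submodule.starProjection_apply_eq_zero_iff, sectorSpace]
  have hle : (⨆ c ∈ S, Module.End.eigenspace (H : E →ₗ[ℂ] E) (c : ℂ)) ≤ (ℂ ∙ x)ᗮ := by
    refine iSup₂_le fun c hc y hy => ?_
    rw [Submodule.mem_orthogonal_singleton_iff_inner_left]
    have hca : (c : ℂ) ≠ a := fun h => ha (by rwa [Complex.ofReal_inj.1 h] at hc)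
    exact Submodule.isOrtho_iff_inner_eq.1
      (hH.isSymmetric.orthogonalFamily_eigenspaces.isOrtho hca) y hy x
      (Module.End.mem_eigenspace_iff.2 hx)
  exact fun y hy => Submodule.mem_orthogonal_singleton_iff_inner_left.1 (hle hy)

/-- An orthonormal eigenbasis of a self-adjoint operator. -/
lemma exists_eigenbasis {H : E →L[ℂ] E} (hH : IsSelfAdjoint H) :
    ∃ (n : ℕ) (b : OrthonormalBasis (Fin n) ℂ E) (a : Fin n → ℝ),
      ∀ j, H (b j) = (a j : ℂ) • b j :=
  ⟨_, hH.isSymmetric.eigenvectorBasis rfl, hH.isSymmetric.eigenvalues rfl,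
    fun j => hH.isSymmetric.apply_eigenvectorBasis rfl j⟩

/-- A unit vector that is almost an eigenvector has an eigenvalue nearby. -/
lemma exists_mem_spectrum_abs_sub_le {H V : E →L[ℂ] E} (hH : IsSelfAdjoint H) {ψ : E} {e : ℝ}
    (hψ : ‖ψ‖ = 1) (he : (H - V) ψ = (e : ℂ) • ψ) : ∃ x ∈ spectrum ℝ H, |x - e| ≤ ‖V‖ := by
  obtain ⟨n, b, a, hb⟩ := exists_eigenbasis hH
  by_contra! hcon
  have hsp : ∀ j, ‖V‖ < |a j - e| := fun j =>
    hcon _ (mem_spectrum_of_apply_eq_smul (b.orthonormal.ne_zero j) (hb j))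
  have hV : V ψ = H ψ - (e : ℂ) • ψ := by
    rw [← he, _root_.sub_apply]; abel
  have hin : ∀ j, ‖inner ℂ (b j) (V ψ)‖ = |a j - e| * ‖inner ℂ (b j) ψ‖ := by
    intro j
    rw [hV, inner_sub_right, inner_eigenbasis_apply b hb, inner_smul_right, ← sub_mul, norm_mul,
      ← Complex.ofReal_sub, Complex.norm_real, Real.norm_eq_abs]
  have h1 := b.sum_sq_norm_inner_right ψ
  have h2 := b.sum_sq_norm_inner_right (V ψ)
  have h3 : ‖V ψ‖ ≤ ‖V‖ := by simpa [hψ] using V.le_opNorm ψ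
  have h4 : ‖V ψ‖ ^ 2 ≤ ‖V‖ ^ 2 := pow_le_pow_left₀ (norm_nonneg _) h3 2
  rw [hψ, one_pow] at h1
  have h5 : ∑ j, ‖V‖ ^ 2 * ‖inner ℂ (b j) ψ‖ ^ 2 < ∑ j, ‖inner ℂ (b j) (V ψ)‖ ^ 2 := by
    have hlt : ∀ j, ‖V‖ ^ 2 < |a j - e| ^ 2 := fun j =>
      pow_lt_pow_left₀ (hsp j) (norm_nonneg _) two_ne_zero
    refine Finset.sum_lt_sum (fun j _ => ?_) ?_
    · rw [hin, mul_pow]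
      exact mul_le_mul_of_nonneg_right (hlt j).le (by positivity)
    · have : ∃ j, ‖inner ℂ (b j) ψ‖ ^ 2 ≠ 0 := by
        by_contra! h0
        simp [h0] at h1
      obtain ⟨j, hj⟩ := this
      refine ⟨j, Finset.mem_univ _, ?_⟩
      rw [hin, mul_pow]
      exact mul_lt_mul_of_pos_right (hlt j) (lt_of_le_of_ne (by positivity) hj.symm)
  rw [← Finset.mul_sum, h1, h2] at h5
  linarith

/-- A filter that approximates the indicator function of `S` on the spectrum of `H`, relative to
the distance from `e`, approximates the spectral projection on eigenvectors of `H - V`. -/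
theorem norm_sectorProj_sub_filter_le {H V : E →L[ℂ] E} (hH : IsSelfAdjoint H) {ψ : E} {e δ : ℝ}
    (hψ : ‖ψ‖ = 1) (he : (H - V) ψ = (e : ℂ) • ψ) (hδ : 0 ≤ δ) {S S' : Set ℝ}
    (hsp : spectrum ℝ H = S ∪ S') (hSS' : Disjoint S S') {ι : Type*} [Fintype ι]
    (q : ℂ) (w : ι → ℂ) (t : ι → ℝ)
    (hin : ∀ x ∈ S, ‖1 - (q + ∑ j, w j * Complex.exp (Complex.I * (t j * (x - e) : ℝ)))‖
      ≤ δ * |x - e|)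
    (hout : ∀ x ∈ S', ‖q + ∑ j, w j * Complex.exp (Complex.I * (t j * (x - e) : ℝ))‖
      ≤ δ * |x - e|) :
    ‖(sectorProj H S - (q • 1 + ∑ j, w j • propagator H V (t j))) ψ‖ ≤ δ * ‖V‖ := by
  obtain ⟨n, b, a, hb⟩ := exists_eigenbasis hH
  -- `D` acts on `ψ` like the operator to be estimated, but, being built from `H` alone, it is
  -- diagonal in the eigenbasis.
  set D : E →L[ℂ] E := sectorProj H S - (q • 1 + ∑ j, (w j *
    Complex.exp (-(Complex.I * (t j * e : ℝ)))) • evol H (t j)) with hD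
  have hDψ : (sectorProj H S - (q • 1 + ∑ j, w j • propagator H V (t j))) ψ = D ψ := by
    rw [hD]
    simp only [_root_.sub_apply, _root_.add_apply,
      _root_.sum_apply, _root_.smul_apply,
      propagator_apply_eigenvector he, smul_smul]
  rw [hDψ]
  have hb0 : ∀ j, b j ≠ 0 := fun j => b.orthonormal.ne_zero j
  classical
  refine norm_apply_le_of_diagonal b hb (c := fun k => (if a k ∈ S then 1 else 0)
    - (q + ∑ j, w j * Complex.exp (Complex.I * (t j * (a k - e) : ℝ)))) (fun k => ?_) hψ he hδ
    fun k => ?_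
  · have h1 : sectorProj H S (b k) = (if a k ∈ S then (1 : ℂ) else 0) • b k := by
      split_ifs with h
      · rw [one_smul]; exact sectorProj_apply_of_mem (hb k) h
      · rw [zero_smul]; exact sectorProj_apply_of_notMem hH (hb k) h
    rw [hD]
    simp only [_root_.sub_apply, _root_.add_apply,
      _root_.sum_apply, _root_.smul_apply,
      one_apply_eq_self, evol_apply_eigenvector (hb k), smul_smul, h1]
    rw [← Finset.sum_smul, ← add_smul, ← sub_smul]
    congr 3
    refine Finset.sum_congr rfl fun j _ => ?_
    rw [mul_assoc, ← Complex.exp_add]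
    congr 2
    push_cast; ring
  · have hk : a k ∈ S ∪ S' := hsp ▸ mem_spectrum_of_apply_eq_smul (hb0 k) (hb k)
    rcases hk with h | h
    · simp only [if_pos h]; exact hin _ h
    · have h' : a k ∉ S := fun h'' => Set.disjoint_left.1 hSS' h'' h
      simp only [if_neg h', zero_sub, norm_neg]; exact hout _ h

lemma abs_le_norm_of_mem_spectrum {H : E →L[ℂ] E} {x : ℝ} (hx : x ∈ spectrum ℝ H) :
    |x| ≤ ‖H‖ := by
  cases subsingleton_or_nontrivial E
  · have : Subsingleton (E →L[ℂ] E) := inferInstance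
    rw [spectrum.of_subsingleton] at hx
    exact hx.elim
  · exact spectrum.norm_le_norm_of_mem hx

lemma finite_spectrum {H : E →L[ℂ] E} : (spectrum ℝ H).Finite := by
  have h : (spectrum ℂ (H : E →ₗ[ℂ] E)).Finite := Module.End.finite_spectrum _
  refine Set.Finite.of_finite_image (f := fun x : ℝ => (x : ℂ)) (h.subset ?_)
    Complex.ofReal_injective.injOn
  rintro _ ⟨x, hx, rfl⟩
  rw [← Module.End.hasEigenvalue_iff_mem_spectrum]
  by_contra hne
  rw [spectrum.mem_iff] at hx
  apply hx
  have hker : LinearMap.ker ((algebraMap ℝ (E →L[ℂ] E) x - H : E →L[ℂ] E) : E →ₗ[ℂ] E) = ⊥ := by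
    rw [LinearMap.ker_eq_bot']
    intro y hy
    by_contra hy0
    refine hne (Module.End.hasEigenvalue_of_hasEigenvector
      (Module.End.hasEigenvector_iff.2 ⟨Module.End.mem_eigenspace_iff.2 ?_, hy0⟩))
    have : (x : ℂ) • y - H y = 0 := by
      rw [← hy, ContinuousLinearMap.coe_coe, _root_.sub_apply,
        Algebra.algebraMap_eq_smul_one, _root_.smul_apply,
        one_apply_eq_self]
      simp
    exact (sub_eq_zero.1 this).symm
  let e := LinearEquiv.ofInjectiveEndo _ (LinearMap.ker_eq_bot.1 hker)
  exact ⟨ContinuousLinearEquiv.toUnit e.toContinuousLinearEquiv, by ext; rfl⟩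

end Spectral

/-! ### The filtered propagator as a substitute for the spectral projection. -/

section Filtering

variable {E : Type u} [NormedAddCommGroup E] [InnerProductSpace ℂ E] [FiniteDimensional ℂ E]

lemma heaviside_of_pos {y : ℝ} (h : 0 < y) : heaviside y = 1 := if_pos h

lemma heaviside_of_nonpos {y : ℝ} (h : y ≤ 0) : heaviside y = 0 := if_neg (not_lt.2 h)

/-- Adds the cost of replacing exact propagators by local ones `U`; only the second moment of the
weights enters. -/
lemma norm_apply_le_of_filter_error {P : E →L[ℂ] E} {H V : E →L[ℂ] E} {ψ : E} (hψ : ‖ψ‖ = 1)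
    {ι : Type*} [Fintype ι] (q : ℂ) (w : ι → ℂ) (t : ι → ℝ) {U : ℝ → E →L[ℂ] E} {δ T κ v m : ℝ}
    (ht : ∀ j, |t j| ≤ T) (hκ : 0 ≤ κ) (hv : 0 ≤ v)
    (hUH : ∀ t, ‖propagator H V t - U t‖ ≤ ‖V‖ * (κ * |t| ^ 2 * Real.exp (v * |t|)))
    (hm : ∑ j, ‖w j‖ * |t j| ^ 2 ≤ m)
    (h : ‖(P - (q • 1 + ∑ j, w j • propagator H V (t j))) ψ‖ ≤ δ * ‖V‖) :
    ‖(P - (q • 1 + ∑ j, w j • U (t j))) ψ‖ ≤ ‖V‖ * (δ + κ * m * Real.exp (v * T)) := by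
  have e : P - (q • 1 + ∑ j, w j • U (t j)) = (P - (q • 1 + ∑ j, w j • propagator H V (t j)))
      + ∑ j, w j • (propagator H V (t j) - U (t j)) := by
    simp only [smul_sub, Finset.sum_sub_distrib]; abel
  have h2 : ‖∑ j, w j • (propagator H V (t j) - U (t j))‖
      ≤ ‖V‖ * (κ * m * Real.exp (v * T)) := by
    calc _ ≤ ∑ j, ‖w j • (propagator H V (t j) - U (t j))‖ := norm_sum_le _ _
      _ ≤ ∑ j, ‖V‖ * (κ * (‖w j‖ * |t j| ^ 2) * Real.exp (v * T)) := by
          refine Finset.sum_le_sum fun j _ => ?_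
          rw [norm_smul]
          calc _ ≤ ‖w j‖ * (‖V‖ * (κ * |t j| ^ 2 * Real.exp (v * T))) := by
                refine mul_le_mul_of_nonneg_left ((hUH _).trans ?_) (norm_nonneg _)
                gcongr
                exact ht j
            _ = _ := by ring
      _ = ‖V‖ * (κ * (∑ j, ‖w j‖ * |t j| ^ 2) * Real.exp (v * T)) := by
          rw [← Finset.mul_sum, ← Finset.sum_mul, ← Finset.mul_sum]
      _ ≤ _ := by gcongr
  rw [e, _root_.add_apply]
  calc _ ≤ δ * ‖V‖ + ‖V‖ * (κ * m * Real.exp (v * T)) := by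
        refine (norm_add_le _ _).trans (add_le_add h (le_trans ?_ h2))
        simpa [hψ] using (∑ j, w j • (propagator H V (t j) - U (t j))).le_opNorm ψ
    _ = _ := by ring

/-- The spectral projection of a gapped sector acts on an eigenvector of the unperturbed operator
like a short-time average of approximate propagators, with the norm bounded by the number of
eigenvalues in the sector. -/
theorem exists_filter_approx {H V : E →L[ℂ] E} (hH : IsSelfAdjoint H) {ψ : E} {e : ℝ}
    (hψ : ‖ψ‖ = 1) (he : (H - V) ψ = (e : ℂ) • ψ) {S S' : Set ℝ} {g L : ℝ} {D : ℕ}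
    (hS : IsGappedSector H S S' g L D) (hg : 0 < g) (hne : S.Nonempty)
    {r ρ T κ v : ℝ} (hr : 0 < r) (hρ : 0 < ρ) (hρr : ρ ≤ r) (hrg : r + 2 * ρ = g / 2) (hT : 0 < T)
    (hV : 2 * ‖V‖ ≤ ρ) (hκ : 0 ≤ κ) (hv : 0 ≤ v) {U : ℝ → E →L[ℂ] E} (hU : ∀ t, ‖U t‖ ≤ 1)
    (hU1 : ∀ t, ‖U t - 1‖ ≤ ‖V‖ * |t|)
    (hUH : ∀ t, ‖propagator H V t - U t‖ ≤ ‖V‖ * (κ * |t| ^ 2 * Real.exp (v * |t|))) :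
    ∃ (n : ℕ) (q : ℂ) (w : Fin n × Bool → ℂ) (t : Fin n × Bool → ℝ),
      ‖q • 1 + ∑ j, w j • U (t j)‖ ≤ S.ncard ∧
      ‖(sectorProj H S - (q • 1 + ∑ j, w j • U (t j))) ψ‖ ≤
        ‖V‖ * ((4 / r + 4 * T + 4 / g) * Real.exp (-(T * r))
          + κ * (2 / ρ * T + T ^ 2) * Real.exp (v * T)) := by
  have hSS' : Disjoint S S' := Set.disjoint_left.2 fun x hx hx' => by
    have := hS.gap x hx x hx'
    rw [sub_self, abs_zero] at this
    linarith
  have hfin : S.Finite := finite_spectrum.subset (hS.spectrum_eq ▸ Set.subset_union_left)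
  have hB : ∀ x ∈ S ∪ S', |x| ≤ ‖H‖ := fun x hx =>
    abs_le_norm_of_mem_spectrum (hS.spectrum_eq ▸ hx)
  have hcard : 1 ≤ S.ncard := (Set.ncard_pos hfin).2 hne
  obtain ⟨x₀, hx₀, hx₀e⟩ := exists_mem_spectrum_abs_sub_le hH hψ he
  rw [hS.spectrum_eq] at hx₀
  have hVρ : ‖V‖ ≤ ρ / 2 := by linarith
  have hxe := abs_le.1 (hx₀e.trans hVρ)
  -- The band filter below has norm up to `2` when `e` is near `S`, which is too much exactly in
  -- this case.
  by_cases hcase : x₀ ∈ S ∧ S.ncard = 1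
  · obtain ⟨hx₀S, hS1⟩ := hcase
    have hSx : S = {x₀} := by
      obtain ⟨y, hy⟩ := Set.ncard_eq_one.1 hS1
      rw [hy] at hx₀S ⊢
      rw [Set.mem_singleton_iff.1 hx₀S]
    obtain ⟨n, w, t, ht, hw, hw1, hw2⟩ := exists_peak_filter ‖H‖ x₀ e hg hT
    refine ⟨n, 0, w, t, ?_, ?_⟩
    · rw [zero_smul, zero_add, hS1, Nat.cast_one, ← hw]
      refine (norm_sum_le _ _).trans (Finset.sum_le_sum fun j _ => ?_)
      rw [norm_smul]
      exact mul_le_of_le_one_right (norm_nonneg _) (hU _)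
    · have h := norm_sectorProj_sub_filter_le (δ := 4 / g * Real.exp (-(T * r))) hH hψ he
        (by positivity) hS.spectrum_eq hSS' 0 w t (fun x hx => ?_) (fun x hx => ?_)
      · have h2 := norm_apply_le_of_filter_error hψ 0 w t ht hκ hv hUH (m := T ^ 2) ?_ h
        · refine h2.trans (mul_le_mul_of_nonneg_left ?_ (norm_nonneg _))
          have h3 : 0 ≤ (4 / r + 4 * T) * Real.exp (-(T * r)) := by positivity
          have h4 : 0 ≤ κ * (2 / ρ * T) * Real.exp (v * T) := by positivity
          linarith
        · calc _ ≤ ∑ j, ‖w j‖ * T ^ 2 := by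
                refine Finset.sum_le_sum fun j _ => mul_le_mul_of_nonneg_left ?_ (norm_nonneg _)
                exact pow_le_pow_left₀ (abs_nonneg _) (ht j) 2
            _ = T ^ 2 := by rw [← Finset.sum_mul, hw, one_mul]
      -- The filter must equal `1` exactly at `x₀`, since the tolerance `δ|x₀ - e|` may be zero.
      · rw [hSx, Set.mem_singleton_iff] at hx
        rw [hx, hw1]; simp; positivity
      · have hgx := hS.gap x₀ hx₀S x hx
        rw [abs_sub_comm] at hgx
        have h3 := hw2 x (hB x (Or.inr hx)) hgx
        rw [zero_add]
        refine h3.trans ?_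
        have h4 : g / 2 ≤ |x - e| := by
          have h5 := abs_sub_abs_le_abs_sub (x - x₀) (e - x₀)
          rw [sub_sub_sub_cancel_right, abs_sub_comm e x₀] at h5
          linarith
        have h6 : Real.exp (-(T * g)) ≤ Real.exp (-(T * r)) :=
          Real.exp_le_exp.2 (by nlinarith)
        calc _ ≤ 2 * Real.exp (-(T * r)) := by linarith
          _ = 4 / g * Real.exp (-(T * r)) * (g / 2) := by field_simp; norm_num
          _ ≤ _ := mul_le_mul_of_nonneg_left h4 (by positivity)
  · obtain ⟨a₀, ha₀, hmin⟩ := Set.exists_min_image S id hfin hne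
    obtain ⟨b₀, hb₀, hmax⟩ := Set.exists_max_image S id hfin hne
    simp only [id] at hmin hmax
    -- The steps sit half a gap beyond the extreme points of `S`, so all of the spectrum keeps
    -- distance `g / 2` from them.
    set a := a₀ - g / 2 with ha
    set b := b₀ + g / 2 with hb
    have hab : a₀ ≤ b₀ := hmin b₀ hb₀
    obtain ⟨α, β, -, hαβ, hdis⟩ := hS.interval
    have hinside : ∀ x ∈ S, g / 2 ≤ x - a ∧ x - b ≤ -(g / 2) := fun x hx =>
      ⟨by linarith [hmin x hx], by linarith [hmax x hx]⟩
    have houtside : ∀ x ∈ S', (x - a ≤ -(g / 2) ∧ x - b ≤ -(g / 2))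
        ∨ (g / 2 ≤ x - a ∧ g / 2 ≤ x - b) := by
      intro x hx
      have hx' : ¬ (a₀ ≤ x ∧ x ≤ b₀) := fun h => Set.disjoint_left.1 hdis
        ⟨(hαβ ha₀).1.trans h.1, h.2.trans (hαβ hb₀).2⟩ hx
      have g1 := hS.gap a₀ ha₀ x hx
      have g2 := hS.gap b₀ hb₀ x hx
      rcases lt_or_ge x a₀ with h | h
      · rw [abs_of_pos (by linarith)] at g1
        exact Or.inl ⟨by linarith, by linarith⟩
      · have h' : b₀ < x := not_le.1 fun h' => hx' ⟨h, h'⟩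
        rw [abs_of_neg (by linarith)] at g2
        exact Or.inr ⟨by linarith, by linarith⟩
    set χ : ℝ → ℝ := fun x => heaviside (x - a) - heaviside (x - b) with hχ
    -- the point `e` belongs to the sector of `x₀`
    have hχe : (r + ρ ≤ |e - a| ∧ r + ρ ≤ |e - b|) ∧ ((x₀ ∈ S ∧ χ e = 1) ∨ χ e = 0) := by
      -- As `g / 2 = r + 2ρ` and `|x₀ - e| ≤ ρ / 2`, the point `e` stays clear of both steps and on
      -- the same side of them as `x₀`.
      rcases hx₀ with h | h
      · obtain ⟨h1, h2⟩ := hinside x₀ h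
        exact ⟨⟨le_abs.2 (Or.inl (by linarith)), le_abs.2 (Or.inr (by linarith))⟩, Or.inl ⟨h, by
          rw [hχ]; simp only
          rw [heaviside_of_pos (by linarith), heaviside_of_nonpos (by linarith), sub_zero]⟩⟩
      · rcases houtside x₀ h with ⟨h1, h2⟩ | ⟨h1, h2⟩
        · exact ⟨⟨le_abs.2 (Or.inr (by linarith)), le_abs.2 (Or.inr (by linarith))⟩, Or.inr (by
            rw [hχ]; simp only
            rw [heaviside_of_nonpos (by linarith), heaviside_of_nonpos (by linarith), sub_zero])⟩
        · exact ⟨⟨le_abs.2 (Or.inl (by linarith)), le_abs.2 (Or.inl (by linarith))⟩, Or.inr (by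
            rw [hχ]; simp only
            rw [heaviside_of_pos (by linarith), heaviside_of_pos (by linarith), sub_self])⟩
    obtain ⟨⟨hea, heb⟩, hχe⟩ := hχe
    obtain ⟨n, w, t, ht, hw, hfil⟩ := exists_band_filter ‖H‖ a b e hr hρ hρr hT hea heb
    -- This constant makes the filter `χ e + ∑ w_j (e^{i t_j (x - e)} - 1)`, exact at `x = e`.
    refine ⟨n, (χ e : ℂ) - ∑ j, w j, w, t, ?_, ?_⟩
    · have e1 : ((χ e : ℂ) - ∑ j, w j) • (1 : E →L[ℂ] E) + ∑ j, w j • U (t j)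
          = (χ e : ℂ) • 1 + ∑ j, w j • (U (t j) - 1) := by
        simp only [smul_sub, Finset.sum_sub_distrib, sub_smul, Finset.sum_smul]; abel
      have h1 : ‖∑ j, w j • (U (t j) - 1)‖ ≤ 1 := by
        calc _ ≤ ∑ j, ‖w j • (U (t j) - 1)‖ := norm_sum_le _ _
          _ ≤ ∑ j, ‖V‖ * (‖w j‖ * |t j|) := by
              refine Finset.sum_le_sum fun j _ => ?_
              rw [norm_smul]
              calc _ ≤ ‖w j‖ * (‖V‖ * |t j|) :=
                    mul_le_mul_of_nonneg_left (hU1 _) (norm_nonneg _)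
                _ = _ := by ring
          _ = ‖V‖ * ∑ j, ‖w j‖ * |t j| := (Finset.mul_sum _ _ _).symm
          _ ≤ ρ / 2 * (2 / ρ) := mul_le_mul hVρ hw
              (Finset.sum_nonneg fun j _ => by positivity) (by positivity)
          _ = 1 := by field_simp
      rw [e1]
      refine (norm_add_le _ _).trans ?_
      rcases hχe with ⟨hxS, h⟩ | h
      · have h2 : 2 ≤ S.ncard := by
          have : S.ncard ≠ 1 := fun h' => hcase ⟨hxS, h'⟩
          omega
        have h3 : (2 : ℝ) ≤ S.ncard := by exact_mod_cast h2
        rw [h, Complex.ofReal_one, one_smul]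
        have := norm_one_le (𝔄 := E →L[ℂ] E)
        linarith
      · have h3 : (1 : ℝ) ≤ S.ncard := by exact_mod_cast hcard
        rw [h, Complex.ofReal_zero, zero_smul, norm_zero]
        linarith
    · have hq : ∀ x, (χ e : ℂ) - ∑ j, w j + ∑ j, w j * Complex.exp (Complex.I * (t j * (x - e) : ℝ))
          = χ e + ∑ j, w j * (Complex.exp (Complex.I * (t j * (x - e) : ℝ)) - 1) := by
        intro x
        simp only [mul_sub, mul_one, Finset.sum_sub_distrib]; ring
      have hle : 2 * ((1 / r + T) * (2 * Real.exp (-(T * r))))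
          ≤ (4 / r + 4 * T + 4 / g) * Real.exp (-(T * r)) := by
        have h3 : 0 ≤ 4 / g * Real.exp (-(T * r)) := by positivity
        have h4 : 2 * ((1 / r + T) * (2 * Real.exp (-(T * r))))
          = (4 / r + 4 * T) * Real.exp (-(T * r)) := by ring
        rw [h4]; linarith
      have herr : ∀ x, |x| ≤ ‖H‖ → r + ρ ≤ |x - a| → r + ρ ≤ |x - b| →
          ‖(χ x : ℂ) - ((χ e : ℂ) - ∑ j, w j
            + ∑ j, w j * Complex.exp (Complex.I * (t j * (x - e) : ℝ)))‖
            ≤ (4 / r + 4 * T + 4 / g) * Real.exp (-(T * r)) * |x - e| := by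
        intro x h1 h2 h3
        refine le_trans ?_ ((hfil x h1 h2 h3).trans
          (mul_le_mul_of_nonneg_right hle (abs_nonneg _)))
        rw [hq, ← sub_sub, ← Complex.ofReal_sub]
      have h := norm_sectorProj_sub_filter_le
        (δ := (4 / r + 4 * T + 4 / g) * Real.exp (-(T * r))) hH hψ he
        (by positivity) hS.spectrum_eq hSS' ((χ e : ℂ) - ∑ j, w j) w t
        (fun x hx => ?_) (fun x hx => ?_)
      · have h2 := norm_apply_le_of_filter_error hψ _ w t ht hκ hv hUH (m := 2 / ρ * T) ?_ h
        · refine h2.trans (mul_le_mul_of_nonneg_left ?_ (norm_nonneg _))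
          have h4 : 0 ≤ κ * T ^ 2 * Real.exp (v * T) := by positivity
          linarith
        · calc _ ≤ ∑ j, ‖w j‖ * |t j| * T := by
                refine Finset.sum_le_sum fun j _ => ?_
                rw [sq, ← mul_assoc]
                exact mul_le_mul_of_nonneg_left (ht j) (by positivity)
            _ ≤ _ := by
                rw [← Finset.sum_mul]; exact mul_le_mul_of_nonneg_right hw hT.le
      · obtain ⟨h1, h2⟩ := hinside x hx
        have h3 := herr x (hB x (Or.inl hx)) (le_abs.2 (Or.inl (by linarith)))
          (le_abs.2 (Or.inr (by linarith)))
        have h4 : χ x = 1 := by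
          rw [hχ]; simp only
          rw [heaviside_of_pos (by linarith), heaviside_of_nonpos (by linarith), sub_zero]
        rwa [h4, Complex.ofReal_one] at h3
      · have h4 : χ x = 0 ∧ r + ρ ≤ |x - a| ∧ r + ρ ≤ |x - b| := by
          rcases houtside x hx with ⟨h1, h2⟩ | ⟨h1, h2⟩
          · exact ⟨by
              rw [hχ]; simp only
              rw [heaviside_of_nonpos (by linarith), heaviside_of_nonpos (by linarith), sub_zero],
              le_abs.2 (Or.inr (by linarith)), le_abs.2 (Or.inr (by linarith))⟩
          · exact ⟨by
              rw [hχ]; simp only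
              rw [heaviside_of_pos (by linarith), heaviside_of_pos (by linarith), sub_self],
              le_abs.2 (Or.inl (by linarith)), le_abs.2 (Or.inl (by linarith))⟩
        have h3 := herr x (hB x (Or.inr hx)) h4.2.1 h4.2.2
        rwa [h4.1, Complex.ofReal_zero, zero_sub, norm_neg] at h3

end Filtering

/-! ### Sums of decay functions. -/

section Decay

variable {Γ : Type u} {G : SimpleGraph Γ} {F₀ : ℝ → ℝ}

lemma expDecay_pos (h : IsDecayFunction G F₀) (μ : ℝ) {r : ℝ} (hr : 0 ≤ r) :
    0 < expDecay F₀ μ r :=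
  mul_pos (Real.exp_pos _) (h.pos r hr)

lemma sum_le_of_tsum_ofReal_le {ι : Type*} {f : ι → ℝ} (hf : ∀ i, 0 ≤ f i) {c : ℝ≥0}
    (h : ∑' i, ENNReal.ofReal (f i) ≤ c) (s : Finset ι) : ∑ i ∈ s, f i ≤ c := by
  have h1 : ENNReal.ofReal (∑ i ∈ s, f i) ≤ c := by
    rw [ENNReal.ofReal_sum_of_nonneg fun i _ => hf i]
    exact (ENNReal.sum_le_tsum s).trans h
  rw [ENNReal.ofReal_le_iff_le_toReal ENNReal.coe_ne_top] at h1
  simpa using h1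

lemma sum_conv_le (h : IsDecayFunction G F₀) {μ : ℝ} {Cμ : ℝ≥0}
    (hC : convConst G (expDecay F₀ μ) = Cμ) (Λ : Finset Γ) (y z : Γ) :
    ∑ u ∈ Λ, expDecay F₀ μ (G.dist y u) * expDecay F₀ μ (G.dist u z)
      ≤ Cμ * expDecay F₀ μ (G.dist y z) := by
  have hpos : ∀ a b, 0 < expDecay F₀ μ (G.dist a b) := fun a b =>
    expDecay_pos h μ (Nat.cast_nonneg _)
  have h1 := sum_le_of_tsum_ofReal_le
    (f := fun u => expDecay F₀ μ (G.dist y u) * expDecay F₀ μ (G.dist u z)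
      / expDecay F₀ μ (G.dist y z))
    (fun u => div_nonneg (mul_nonneg (hpos _ _).le (hpos _ _).le) (hpos _ _).le)
    (by rw [← hC]; exact le_iSup_of_le y (le_iSup_of_le z le_rfl)) Λ
  rwa [← Finset.sum_div, div_le_iff₀ (hpos _ _)] at h1

lemma sum_decay_le {μ : ℝ} (hμ : 0 ≤ μ) (h : IsDecayFunction G F₀) {N : ℝ≥0}
    (hN : decayNorm G F₀ = N) {Λ K : Finset Γ} [DecidableEq Γ] (l : ℝ) :
    ∑ y ∈ K, ∑ z ∈ Λ \ fattening G Λ K l, expDecay F₀ μ (G.dist y z)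
      ≤ K.card * (Real.exp (-(μ * l)) * N) := by
  rw [← nsmul_eq_mul]
  refine Finset.sum_le_card_nsmul _ _ _ fun y hy => ?_
  calc _ ≤ ∑ z ∈ Λ \ fattening G Λ K l, Real.exp (-(μ * l)) * F₀ (G.dist y z) := by
        refine Finset.sum_le_sum fun z hz => ?_
        refine mul_le_mul_of_nonneg_right (Real.exp_le_exp.2 ?_) (h.pos _ (Nat.cast_nonneg _)).le
        obtain ⟨hz1, hz2⟩ := Finset.mem_sdiff.1 hz
        have h1 : l < G.dist y z := by
          by_contra! hl
          exact hz2 (Finset.mem_filter.2 ⟨hz1, y, hy, hl⟩)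
        nlinarith
    _ = Real.exp (-(μ * l)) * ∑ z ∈ Λ \ fattening G Λ K l, F₀ (G.dist y z) :=
        (Finset.mul_sum _ _ _).symm
    _ ≤ _ := by
        refine mul_le_mul_of_nonneg_left ?_ (Real.exp_pos _).le
        exact sum_le_of_tsum_ofReal_le (f := fun z => F₀ (G.dist y z))
          (fun z => (h.pos _ (Nat.cast_nonneg _)).le) (hN ▸ le_iSup_of_le y le_rfl) _

lemma fattening_subset (Λ K : Finset Γ) (l : ℝ) : fattening G Λ K l ⊆ Λ :=
  Finset.filter_subset _ _

lemma subset_fattening {Λ K : Finset Γ} (hK : K ⊆ Λ) {l : ℝ} (hl : 0 ≤ l) :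
    K ⊆ fattening G Λ K l := fun x hx =>
  Finset.mem_filter.2 ⟨hK hx, x, hx, by simpa using hl⟩

end Decay

/-! ### The Hamiltonian as a sum of local terms. -/

section Model

variable {Γ : Type u} [DecidableEq Γ] {d : Γ → ℕ}

lemma sum_interaction_le {G : SimpleGraph Γ} {F₀ : ℝ → ℝ} (h : IsDecayFunction G F₀) {μ : ℝ}
    {Φ : (X : Finset Γ) → Obs d X} {J : ℝ≥0} (hJ : interactionNorm' G (expDecay F₀ μ) Φ = J)
    (Λ : Finset Γ) (y z : Γ) :
    ∑ Z ∈ Λ.powerset.filter (fun Z => (y ∈ Z ∧ z ∈ Z) ∧ 1 < Z.card), ‖Φ Z‖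
      ≤ J * expDecay F₀ μ (G.dist y z) := by
  have hpos : 0 < expDecay F₀ μ (G.dist y z) := expDecay_pos h μ (Nat.cast_nonneg _)
  have h1 := sum_le_of_tsum_ofReal_le
    (f := fun Z : {X : Finset Γ // (y ∈ X ∧ z ∈ X) ∧ 1 < X.card} =>
      ‖Φ Z.1‖ / expDecay F₀ μ (G.dist y z))
    (fun Z => div_nonneg (norm_nonneg _) hpos.le)
    (by rw [← hJ]; exact le_iSup_of_le y (le_iSup_of_le z le_rfl)) (Λ.powerset.subtype _)
  rwa [← Finset.sum_div, div_le_iff₀ hpos,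
    Finset.sum_subtype_eq_sum_filter (f := fun Z => ‖Φ Z‖)] at h1

/-- The terms of the Hamiltonian `H_Λ(s)`, sorted by their supports. -/
def localTerm (Φ : (X : Finset Γ) → Obs d X) {Λ K : Finset Γ} (hK : K ⊆ Λ)
    (W : (x : Γ) → ℝ → Obs d {x}) (s : ℝ) (Z : Finset Γ) : Obs d Λ :=
  (if h : Z ⊆ Λ then embed h (Φ Z) else 0) + ∑ x ∈ K.attach,
    if Z = {x.1} then embed (Finset.singleton_subset_iff.mpr (hK x.2)) (W x s) else 0

variable {Φ : (X : Finset Γ) → Obs d X} {Λ K : Finset Γ} {hK : K ⊆ Λ}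
  {W : (x : Γ) → ℝ → Obs d {x}}

lemma isSelfAdjoint_sum_obs {ι : Type*} {X : Finset Γ} {f : ι → Obs d X} (S : Finset ι)
    (hf : ∀ j ∈ S, IsSelfAdjoint (f j)) : IsSelfAdjoint (∑ j ∈ S, f j) :=
  sum_mem (S := selfAdjoint (Obs d X)) hf

lemma sum_localTerm (s : ℝ) :
    ∑ Z ∈ Λ.powerset, localTerm Φ hK W s Z = hamiltonianPath Φ hK W s := by
  simp only [localTerm]
  rw [Finset.sum_add_distrib, hamiltonianPath, hamiltonian, perturbation]
  congr 1
  · rw [← Finset.sum_attach]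
    refine Finset.sum_congr rfl fun Z _ => ?_
    rw [dif_pos (Finset.mem_powerset.1 Z.2)]
  · rw [Finset.sum_comm]
    refine Finset.sum_congr rfl fun x _ => ?_
    rw [Finset.sum_ite_eq', if_pos (Finset.mem_powerset.2 (Finset.singleton_subset_iff.2 (hK x.2)))]

lemma isSelfAdjoint_localTerm (hΦ : ∀ X, IsSelfAdjoint (Φ X)) {s : ℝ}
    (hW : ∀ x ∈ K, IsSelfAdjoint (W x s)) (Z : Finset Γ) :
    IsSelfAdjoint (localTerm Φ hK W s Z) := by
  have h0 : IsSelfAdjoint (0 : Obs d Λ) := IsSelfAdjoint.zero (Obs d Λ)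
  have h1 : IsSelfAdjoint (if h : Z ⊆ Λ then embed h (Φ Z) else 0) := by
    split_ifs with h
    exacts [isSelfAdjoint_embed h (hΦ Z), h0]
  have h2 : IsSelfAdjoint (∑ x ∈ K.attach, if Z = {x.1} then
      embed (Finset.singleton_subset_iff.mpr (hK x.2)) (W x s) else 0) := by
    refine isSelfAdjoint_sum_obs (X := Λ) K.attach fun x _ => ?_
    split_ifs with h
    exacts [isSelfAdjoint_embed _ (hW x.1 x.2), h0]
  exact (selfAdjoint (Obs d Λ)).add_mem h1 h2

lemma localTerm_eq_zero {s : ℝ} {Z : Finset Γ} (hZ : ¬ Z ⊆ Λ) : localTerm Φ hK W s Z = 0 := by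
  rw [localTerm, dif_neg hZ, zero_add]
  refine Finset.sum_eq_zero fun x _ => if_neg fun h => hZ ?_
  rw [h]; exact Finset.singleton_subset_iff.2 (hK x.2)

lemma isSupportedIn_localTerm {s : ℝ} {Z : Finset Γ} (hZ : Z ⊆ Λ) :
    IsSupportedIn Z (localTerm Φ hK W s Z) := by
  rw [isSupportedIn_iff hZ, localTerm, dif_pos hZ]
  refine add_mem ⟨Φ Z, rfl⟩ (sum_mem fun x _ => ?_)
  split_ifs with h
  · subst h
    exact ⟨W x s, rfl⟩
  · exact zero_mem _

lemma commute_localTerm {s : ℝ} {Y Z : Finset Γ} (h : Disjoint Y Z) :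
    Commute (localTerm Φ hK W s Y) (localTerm Φ hK W s Z) := by
  by_cases hY : Y ⊆ Λ
  · by_cases hZ : Z ⊆ Λ
    · exact (isSupportedIn_localTerm hY).commute h (isSupportedIn_localTerm hZ)
    · rw [localTerm_eq_zero hZ]; exact Commute.zero_right _
  · rw [localTerm_eq_zero hY]; exact Commute.zero_left _

/-- `W` contributes single-site terms only, so it does not affect the propagation speed. -/
lemma norm_localTerm_le {s : ℝ} {Z : Finset Γ} (hZ : 1 < Z.card) :
    ‖localTerm Φ hK W s Z‖ ≤ ‖Φ Z‖ := by
  rw [localTerm, Finset.sum_eq_zero (fun x _ => if_neg fun h => ?_), add_zero]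
  · split_ifs with h
    · exact norm_embed_le h _
    · simp
  · rw [h, Finset.card_singleton] at hZ
    exact lt_irrefl _ hZ

lemma isSupportedIn_perturbation (s : ℝ) : IsSupportedIn K (perturbation hK W s) := by
  rw [isSupportedIn_iff hK]
  refine sum_mem fun x _ => ?_
  exact (isSupportedIn_iff hK).1
    (IsSupportedIn.mono (Finset.singleton_subset_iff.2 x.2) hK ⟨_, _, rfl⟩)

lemma isSelfAdjoint_perturbation {s : ℝ} (hW : ∀ x ∈ K, IsSelfAdjoint (W x s)) :
    IsSelfAdjoint (perturbation hK W s) := 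
  isSelfAdjoint_sum_obs _ fun x _ => isSelfAdjoint_embed _ (hW x.1 x.2)

lemma norm_perturbation_sub_le {CW : ℝ} (h : IsPerturbation hK W CW) {s t : ℝ}
    (hs : s ∈ Set.Icc (0 : ℝ) 1) (ht : t ∈ Set.Icc (0 : ℝ) 1) :
    ‖perturbation hK W t - perturbation hK W s‖ ≤ CW * |t - s| := by
  have hd : DifferentiableOn ℝ (perturbation hK W) (Set.Icc 0 1) := by
    have e : perturbation hK W = fun s => ∑ x ∈ K.attach,
        embed (Finset.singleton_subset_iff.mpr (hK x.2)) (W x s) := rfl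
    rw [e]
    refine DifferentiableOn.fun_sum fun x _ => ?_
    let f : Obs d {x.1} →L[ℂ] Obs d Λ := LinearMap.toContinuousLinearMap
      (embedHom d (Finset.singleton_subset_iff.mpr (hK x.2))).toAlgHom.toLinearMap
    exact (f.restrictScalars ℝ).differentiable.comp_differentiableOn
      ((h.smooth x.1 x.2).differentiableOn (by simp))
  have := (convex_Icc (0 : ℝ) 1).norm_image_sub_le_of_norm_derivWithin_le hd h.deriv_le hs ht
  rwa [Real.norm_eq_abs] at this

end Model

/-! ### Choice of the decay rate. -/

section Constants

/-- At `r = g / 2` the rate on the right is exactly `1/ξ`. By continuity, `r` slightly below `g / 2`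
still beats `μ'`, and the remaining room is used for the smoothing width `ρ`. -/
lemma exists_rate {μ g : ℝ} {Cμ J : ℝ≥0} (hμ : 0 < μ) (hg : 0 < g) {μ' : ℝ}
    (h : μ' < 1 / localityLength μ g Cμ J) :
    ∃ r ρ : ℝ, 0 < r ∧ 0 < ρ ∧ ρ ≤ r ∧ r + 2 * ρ = g / 2 ∧
      μ' < r * μ / (2 * J * Cμ + r) := by
  have hv : (0 : ℝ) ≤ 2 * J * Cμ := by positivity
  have e : 1 / localityLength μ g Cμ J = g / 2 * μ / (2 * J * Cμ + g / 2) := by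
    rw [localityLength, one_div_div]
    field_simp
    ring
  rw [e] at h
  have hc : ContinuousAt (fun r : ℝ => r * μ / (2 * J * Cμ + r)) (g / 2) := by
    refine ContinuousAt.div (by fun_prop) (by fun_prop) ?_
    positivity
  have h1 : ∀ᶠ r in nhdsWithin (g / 2) (Set.Iio (g / 2)), μ' < r * μ / (2 * J * Cμ + r) :=
    (hc.eventually (lt_mem_nhds h)).filter_mono nhdsWithin_le_nhds
  have h2 : ∀ᶠ r in nhdsWithin (g / 2) (Set.Iio (g / 2)), r ∈ Set.Ioo (g / 4) (g / 2) :=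
    Ioo_mem_nhdsLT (by linarith)
  obtain ⟨r, h3, h4⟩ := (h1.and h2).exists
  exact ⟨r, (g / 2 - r) / 2, by linarith [h4.1], by linarith [h4.2], by linarith [h4.1],
    by ring, h3⟩

lemma one_add_mul_sq_le {θ β l : ℝ} (hθ : 0 ≤ θ) (hβ : 0 < β) (hl : 0 ≤ l) :
    (1 + θ * l) ^ 2 ≤ (1 + 2 * θ / β) ^ 2 * Real.exp (β * l) := by
  have h1 : 1 + θ * l ≤ (1 + 2 * θ / β) * Real.exp (β * l / 2) := by
    have h2 := Real.add_one_le_exp (β * l / 2)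
    calc 1 + θ * l ≤ (1 + 2 * θ / β) * (β * l / 2 + 1) := by
          have h3 : (1 + 2 * θ / β) * (β * l / 2 + 1)
            = 1 + θ * l + (β * l / 2 + 2 * θ / β) := by field_simp; ring
          rw [h3]
          have : 0 ≤ β * l / 2 + 2 * θ / β := by positivity
          linarith
      _ ≤ _ := mul_le_mul_of_nonneg_left h2 (by positivity)
  calc _ ≤ ((1 + 2 * θ / β) * Real.exp (β * l / 2)) ^ 2 :=
        pow_le_pow_left₀ (by positivity) h1 2
    _ = _ := by rw [mul_pow, ← Real.exp_nat_mul]; congr 2; push_cast; ring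

end Constants

/-! ### Localisation for the spin Hamiltonian. -/

section Approximation

variable {Γ : Type u} [DecidableEq Γ] {d : Γ → ℕ} {G : SimpleGraph Γ} {F₀ : ℝ → ℝ}
  {Φ : (X : Finset Γ) → Obs d X} {Λ K : Finset Γ} {hK : K ⊆ Λ} {W : (x : Γ) → ℝ → Obs d {x}}

lemma isSelfAdjoint_hamiltonianPath (hΦ : ∀ X, IsSelfAdjoint (Φ X)) {s : ℝ}
    (hW : ∀ x ∈ K, IsSelfAdjoint (W x s)) : IsSelfAdjoint (hamiltonianPath Φ hK W s) := by
  rw [← sum_localTerm]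
  exact isSelfAdjoint_sum_obs (X := Λ) _ fun Z _ => isSelfAdjoint_localTerm hΦ hW Z

lemma isSupportedIn_sum_localTerm (s : ℝ) {M : Finset Γ} (hM : M ⊆ Λ) :
    IsSupportedIn M (∑ Z ∈ M.powerset, localTerm Φ hK W s Z) := by
  rw [isSupportedIn_iff hM]
  refine sum_mem fun Z hZ => ?_
  have hZM := Finset.mem_powerset.1 hZ
  exact (isSupportedIn_iff hM).1 ((isSupportedIn_localTerm (hZM.trans hM)).mono hZM hM)

lemma isSupportedIn_linearCombination {ι : Type*} [Fintype ι] {M : Finset Γ} (hM : M ⊆ Λ)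
    {U : ι → Obs d Λ} (hU : ∀ j, IsSupportedIn M (U j)) (q : ℂ) (w : ι → ℂ) :
    IsSupportedIn M (q • 1 + ∑ j, w j • U j) := by
  rw [isSupportedIn_iff hM]
  exact add_mem (Subalgebra.smul_mem _ (one_mem _) _)
    (sum_mem fun j _ => Subalgebra.smul_mem _ ((isSupportedIn_iff hM).1 (hU j)) _)

/-- The propagator for a perturbation on `K` is approximated by that of the Hamiltonian restricted
to a neighbourhood `M` of `K`. -/
lemma norm_propagator_sub_propagator_restrict_le (hF : IsDecayFunction G F₀) {μ : ℝ} {Cμ J : ℝ≥0}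
    (hC : convConst G (expDecay F₀ μ) = Cμ) (hΦ : ∀ X, IsSelfAdjoint (Φ X))
    (hJ : interactionNorm' G (expDecay F₀ μ) Φ = J) {s : ℝ}
    (hW : ∀ x ∈ K, IsSelfAdjoint (W x s)) {M : Finset Γ} (hKM : K ⊆ M) (hM : M ⊆ Λ)
    {V : Obs d Λ} (hV : IsSelfAdjoint V) (hVK : IsSupportedIn K V) (t : ℝ) :
    ‖propagator (hamiltonianPath Φ hK W s) V t
      - propagator (∑ Z ∈ M.powerset, localTerm Φ hK W s Z) V t‖
      ≤ ‖V‖ * ((∑ y ∈ K, ∑ z ∈ Λ \ M, expDecay F₀ μ (G.dist y z)) * (2 * J) * |t| ^ 2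
        * Real.exp (2 * J * Cμ * |t|)) := by
  have h := norm_propagator_sub_propagator_le hM (isSelfAdjoint_localTerm (hK := hK) hΦ hW)
    (fun Y Z h => commute_localTerm h) (F := fun y z => expDecay F₀ μ (G.dist y z))
    (fun y z => (expDecay_pos hF μ (Nat.cast_nonneg _)).le) (NNReal.coe_nonneg J)
    (NNReal.coe_nonneg Cμ)
    (fun y _ z _ => (Finset.sum_le_sum fun Z hZ =>
      norm_localTerm_le (Finset.mem_filter.1 hZ).2.2).trans (sum_interaction_le hF hJ Λ y z))
    (fun y _ z _ => sum_conv_le hF hC Λ y z) hKM hV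
    (fun Z hZ hd => hVK.commute hd (isSupportedIn_localTerm hZ)) t
  rw [sum_localTerm] at h
  refine h.trans_eq ?_
  ring

end Approximation

/-! ### Balancing the two errors. -/

section Constants

/-- For `T = θ l` the relation `θ (v + r) = μ` makes `e^{vT - μ l}` equal to `e^{-Tr}`. The
polynomial prefactor in `T` is absorbed by the surplus rate `β`. -/
lemma filter_error_le {μ g r ρ v κ N θ β μ' l : ℝ} (hg : 0 < g) (hr : 0 < r) (hρ : 0 < ρ)
    (hN : 0 ≤ N) (hθ : 0 < θ) (hθv : θ * (v + r) = μ) (hβ : 0 < β) (hβr : β = θ * r - μ')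
    (hl : 0 < l) (hκ : κ ≤ N * Real.exp (-(μ * l))) :
    (4 / r + 4 * (θ * l) + 4 / g) * Real.exp (-(θ * l * r))
        + κ * (2 / ρ * (θ * l) + (θ * l) ^ 2) * Real.exp (v * (θ * l))
      ≤ (4 / r + 4 + 4 / g + N * (2 / ρ + 1)) * (1 + 2 * θ / β) ^ 2 * Real.exp (-μ' * l) := by
  set T := θ * l with hT
  have hT0 : 0 < T := mul_pos hθ hl
  set A : ℝ := 4 / r + 4 + 4 / g + N * (2 / ρ + 1) with hA
  have hA0 : 0 ≤ A := by positivity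
  have hexp : Real.exp (-(μ * l)) * Real.exp (v * T) = Real.exp (-(T * r)) := by
    rw [← Real.exp_add]
    congr 1
    rw [hT, ← hθv]; ring
  have hexp2 : Real.exp (β * l) * Real.exp (-(T * r)) = Real.exp (-μ' * l) := by
    rw [← Real.exp_add]
    congr 1
    rw [hT, hβr]; ring
  have h1 : κ * (2 / ρ * T + T ^ 2) * Real.exp (v * T)
      ≤ N * (2 / ρ * T + T ^ 2) * Real.exp (-(T * r)) := by
    calc _ ≤ N * Real.exp (-(μ * l)) * (2 / ρ * T + T ^ 2) * Real.exp (v * T) := by gcongr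
      _ = N * (2 / ρ * T + T ^ 2) * (Real.exp (-(μ * l)) * Real.exp (v * T)) := by ring
      _ = _ := by rw [hexp]
  have h2 : 4 / r + 4 * T + 4 / g + N * (2 / ρ * T + T ^ 2) ≤ A * (1 + T) ^ 2 := by
    have e : A * (1 + T) ^ 2 - (4 / r + 4 * T + 4 / g + N * (2 / ρ * T + T ^ 2))
        = (4 / r + 4 / g) * (2 * T + T ^ 2) + 4 * (1 + T + T ^ 2)
          + N * (2 / ρ) * (1 + T + T ^ 2) + N * (1 + 2 * T) := by rw [hA]; ring
    have : 0 ≤ A * (1 + T) ^ 2 - (4 / r + 4 * T + 4 / g + N * (2 / ρ * T + T ^ 2)) := by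
      rw [e]; positivity
    linarith
  have h3 := one_add_mul_sq_le hθ.le hβ hl.le
  calc _ ≤ (4 / r + 4 * T + 4 / g + N * (2 / ρ * T + T ^ 2)) * Real.exp (-(T * r)) := by
        linarith
    _ ≤ A * ((1 + 2 * θ / β) ^ 2 * Real.exp (β * l)) * Real.exp (-(T * r)) :=
        mul_le_mul_of_nonneg_right (h2.trans (mul_le_mul_of_nonneg_left h3 hA0))
          (Real.exp_pos _).le
    _ = _ := by rw [← hexp2]; ring

end Constants

end SpinSystem
end

/-! ### Assembly of the proof. -/

theorem proposition3p1
    -- the parameters on which the constants may depend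
    (μ g CW L : ℝ) (normF Cμ normΦ : ℝ≥0) (D k : ℕ) (hμ : 0 < μ) (hg : 0 < g)
    (μ' : ℝ) (hμ' : μ' < 1 / SpinSystem.localityLength μ g Cμ normΦ) :
    ∃ ε₀ : ℝ, 0 < ε₀ ∧ ∃ C : ℝ,
      -- the infinite volume, the single-site dimensions, the decay functions and the interaction
      ∀ (Γ : Type*) [DecidableEq Γ] (G : SimpleGraph Γ) (d : Γ → ℕ) (F₀ : ℝ → ℝ)
        (Φ : (X : Finset Γ) → SpinSystem.Obs d X),
        G.Connected →
        SpinSystem.IsDecayFunction G F₀ →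
        SpinSystem.decayNorm G F₀ = normF →
        SpinSystem.convConst G (SpinSystem.expDecay F₀ μ) = Cμ →
        (∀ X, IsSelfAdjoint (Φ X)) →
        SpinSystem.interactionNorm G (SpinSystem.expDecay F₀ μ) Φ < ⊤ →
        SpinSystem.interactionNorm' G (SpinSystem.expDecay F₀ μ) Φ = normΦ →
      -- the volume, the perturbation, the gapped sector and its eigenvectors
      ∀ (Λ K : Finset Γ) (hK : K ⊆ Λ) (W : (x : Γ) → ℝ → SpinSystem.Obs d {x})
        (σin σout : ℝ → Set ℝ) (ev : ℝ → Fin D → ℝ) (ψ : ℝ → Fin D → SpinSystem.HSpace d Λ),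
        (G.induce (Λ : Set Γ)).Connected →
        K.card = k →
        SpinSystem.IsPerturbation hK W CW →
        (∀ s ∈ Set.Icc (0 : ℝ) 1, SpinSystem.IsGappedSector
          (SpinSystem.hamiltonianPath Φ hK W s) (σin s) (σout s) g L D) →
        (∀ s ∈ Set.Icc (0 : ℝ) 1, Orthonormal ℂ (ψ s) ∧ ∀ i, ev s i ∈ σin s ∧
          SpinSystem.hamiltonianPath Φ hK W s (ψ s i) = (ev s i : ℂ) • ψ s i) →
      ∀ ε : ℝ, 0 < ε → ε < ε₀ → ∀ s₀ ∈ Set.Icc (0 : ℝ) (1 - ε), ∀ (i : Fin D) (l : ℝ), 0 < l →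
        ∃ R : SpinSystem.Obs d Λ,
          SpinSystem.IsSupportedIn (SpinSystem.fattening G Λ K l) R ∧
          ‖R‖ ≤ (σin (s₀ + ε)).ncard ∧
          ‖(SpinSystem.sectorProj (SpinSystem.hamiltonianPath Φ hK W (s₀ + ε)) (σin (s₀ + ε)) - R)
              (ψ s₀ i)‖ ≤ C * ε * Real.exp (-μ' * l) := by
  obtain ⟨r, ρ, hr, hρ, hρr, hrg, hrate⟩ := SpinSystem.exists_rate hμ hg hμ'
  have hv0 : (0 : ℝ) ≤ 2 * normΦ * Cμ := by positivity
  have hθ0 : 0 < μ / (2 * normΦ * Cμ + r) := by positivity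
  obtain ⟨θ, hθ⟩ : ∃ θ, θ = μ / (2 * normΦ * Cμ + r) := ⟨_, rfl⟩
  have hθv : θ * (2 * normΦ * Cμ + r) = μ := by rw [hθ]; field_simp
  rw [← hθ] at hθ0
  have hβ0 : 0 < θ * r - μ' := by
    have e : r * μ / (2 * normΦ * Cμ + r) = θ * r := by rw [hθ]; ring
    rw [e] at hrate
    exact sub_pos.2 hrate
  -- The threshold ensures `2‖V‖ ≤ ρ`, as the filter requires. The absolute value and the added `1`
  -- are there because the constants are fixed before `CW` is known to be nonnegative.
  refine ⟨ρ / (2 * (|CW| + 1)), by positivity, |CW| *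
    ((4 / r + 4 + 4 / g + k * normF * (2 * normΦ) * (2 / ρ + 1))
      * (1 + 2 * θ / (θ * r - μ')) ^ 2), ?_⟩
  intro Γ _ G d F₀ Φ _ hF hnormF hCμ hΦ _ hnormΦ Λ K hK W σin σout ev ψ _ hk hW hgap hψ
    ε hε hεlt s₀ hs₀ i l hl
  have hs0 : s₀ ∈ Set.Icc (0 : ℝ) 1 := ⟨hs₀.1, by linarith [hs₀.2]⟩
  have hs1 : s₀ + ε ∈ Set.Icc (0 : ℝ) 1 := ⟨by linarith [hs₀.1], by linarith [hs₀.2]⟩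
  have hM := SpinSystem.fattening_subset (G := G) Λ K l
  have hKM := SpinSystem.subset_fattening (G := G) hK hl.le
  have hW0 := fun x hx => hW.selfAdjoint x hx _ hs0
  have hW1 := fun x hx => hW.selfAdjoint x hx _ hs1
  obtain ⟨V, hV⟩ : ∃ V, V = SpinSystem.perturbation hK W (s₀ + ε)
    - SpinSystem.perturbation hK W s₀ := ⟨_, rfl⟩
  have hVsa : IsSelfAdjoint V := hV ▸ (selfAdjoint (SpinSystem.Obs d Λ)).sub_mem
    (SpinSystem.isSelfAdjoint_perturbation hW1) (SpinSystem.isSelfAdjoint_perturbation hW0)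
  have hVK : SpinSystem.IsSupportedIn K V := by
    have h1 := SpinSystem.isSupportedIn_perturbation (hK := hK) (W := W) (s₀ + ε)
    have h2 := SpinSystem.isSupportedIn_perturbation (hK := hK) (W := W) s₀
    rw [SpinSystem.isSupportedIn_iff hK] at h1 h2 ⊢
    rw [hV]
    exact sub_mem h1 h2
  have hHV : SpinSystem.hamiltonianPath Φ hK W (s₀ + ε) - V
      = SpinSystem.hamiltonianPath Φ hK W s₀ := by
    rw [hV, SpinSystem.hamiltonianPath, SpinSystem.hamiltonianPath]; abel
  have hVnorm : ‖V‖ ≤ |CW| * ε := by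
    have h := SpinSystem.norm_perturbation_sub_le hW hs0 hs1
    rw [add_sub_cancel_left, abs_of_pos hε, ← hV] at h
    exact h.trans (mul_le_mul_of_nonneg_right (le_abs_self _) hε.le)
  have hVρ : 2 * ‖V‖ ≤ ρ := by
    rw [lt_div_iff₀ (by positivity)] at hεlt
    linarith
  have hHM := SpinSystem.isSupportedIn_sum_localTerm (Φ := Φ) (hK := hK) (W := W) (s₀ + ε) hM
  have hMsa := SpinSystem.isSelfAdjoint_sum_obs (SpinSystem.fattening G Λ K l).powerset
    fun Z _ => SpinSystem.isSelfAdjoint_localTerm (hK := hK) hΦ hW1 Z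
  have hUH := SpinSystem.norm_propagator_sub_propagator_restrict_le (hK := hK) hF hCμ hΦ hnormΦ hW1
    hKM hM hVsa hVK
  have hσ := SpinSystem.sum_decay_le hμ.le hF hnormF (Λ := Λ) (K := K) l
  have hσ0 : 0 ≤ ∑ y ∈ K, ∑ z ∈ Λ \ SpinSystem.fattening G Λ K l,
      SpinSystem.expDecay F₀ μ (G.dist y z) :=
    Finset.sum_nonneg fun y _ => Finset.sum_nonneg fun z _ =>
      (SpinSystem.expDecay_pos hF μ (Nat.cast_nonneg _)).le
  obtain ⟨hon, hev⟩ := hψ s₀ hs0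
  -- The time cutoff is `T = θ * l`, and `U` is the propagator of the terms inside `K_l`. The sector
  -- at `s₀ + ε` is nonempty because it contains the eigenvalue with index `i`.
  obtain ⟨n, q, w, t, hR1, hR2⟩ := SpinSystem.exists_filter_approx
    (SpinSystem.isSelfAdjoint_hamiltonianPath hΦ hW1) (hon.1 i) (by rw [hHV]; exact (hev i).2)
    (hgap _ hs1) hg ⟨_, ((hψ _ hs1).2 i).1⟩ hr hρ hρr hrg (mul_pos hθ0 hl) hVρ
    (mul_nonneg hσ0 (by positivity)) hv0 (SpinSystem.norm_propagator_le hMsa hVsa)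
    (SpinSystem.norm_propagator_sub_one_le hMsa hVsa) hUH
  refine ⟨_, SpinSystem.isSupportedIn_linearCombination hM
    (fun j => hHM.propagator (hVK.mono hKM hM) (t j)) q w, hR1, hR2.trans ?_⟩
  have hκ : (∑ y ∈ K, ∑ z ∈ Λ \ SpinSystem.fattening G Λ K l,
      SpinSystem.expDecay F₀ μ (G.dist y z)) * (2 * normΦ)
      ≤ k * normF * (2 * normΦ) * Real.exp (-(μ * l)) := by
    rw [← hk]
    calc _ ≤ K.card * (Real.exp (-(μ * l)) * normF) * (2 * normΦ) :=
          mul_le_mul_of_nonneg_right hσ (by positivity)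
      _ = _ := by ring
  have herr := SpinSystem.filter_error_le hg hr hρ (by positivity) hθ0 hθv hβ0 rfl hl hκ
  calc _ ≤ ‖V‖ * _ := mul_le_mul_of_nonneg_left herr (norm_nonneg _)
    _ ≤ |CW| * ε * _ := mul_le_mul_of_nonneg_right hVnorm (by positivity)
    _ = _ := by ring
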